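/- Let $\mathcal A$ be the antitree with sphere numbers $s_n=n+1$, $n\ge 0$: its vertex set is the disjoint union of the sets $S_n$ with $\#S_n=n+1$, $n\in\mathbb Z_{\ge 0}$, and two vertices are joined by an edge if and only if they lie in consecutive sets $S_n$, $S_{n+1}$. Given a length $|e|\in(0,\infty)$ for every edge $e$, direct the edges arbitrarily and identify each $e$ with the interval $[0,|e|]$; put $L^2(\mathcal A)=\bigoplus_e L^2(e)$ (complex-valued functions). The minimal Kirchhoff Laplacian $\mathbf H_0$ is the closure in $L^2(\mathcal A)$ of the operator $f\mapsto -f''$ (edgewise) defined on those $f\in L^2(\mathcal A)$ that vanish on all but finitely many edges, belong to $H^2(e)$ for every edge $e$ and satisfy the Kirchhoff conditions at every vertex $v$: $f$ is continuous at $v$, and the sum of the derivatives of $f$ at $v$, taken along all edges incident to $v$ in the direction out of $v$, is zero. Its deficiency indices are $\mathrm n_\pm(\mathbf H_0)=\dim\ker(\mathbf H_0^*\mp \mathrm i)\in\mathbb Z_{\ge 0}\cup\{\infty\}$. Theorem. For every $N\in\mathbb Z_{\ge 1}\cup\{\infty\}$ there are edge lengths $|e|\in(0,\infty)$ such that the minimal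 Kirchhoff Laplacian $\mathbf H_0$ on the resulting metric antitree satisfies $\mathrm n_+(\mathbf H_0)=\mathrm n_-(\mathbf H_0)=N$. -/

import Mathlib

open MeasureTheory Set

noncomputable section

namespace QuantumGraph

/-! ### Sobolev spaces on an interval -/

/-- `f` belongs to `H¹(0, L)`: it is absolutely continuous on `[0, L]` and `f' ∈ L²(0, L)`.
Only the values of `f` on `[0, L]` matter. -/
def MemH1 (L : ℝ) (f : ℝ → ℂ) : Prop :=
  AbsolutelyContinuousOnInterval f 0 L ∧
    MemLp (derivWithin f (Icc 0 L)) 2 (volume.restrict (Icc 0 L))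

/-- `f` belongs to `H²(0, L)`: both `f` and `f'` belong to `H¹(0, L)`. -/
def MemH2 (L : ℝ) (f : ℝ → ℂ) : Prop :=
  MemH1 L f ∧ MemH1 L (derivWithin f (Icc 0 L))

/-- The second derivative on `[0, L]`. -/
def secondDeriv (L : ℝ) (f : ℝ → ℂ) : ℝ → ℂ :=
  derivWithin (derivWithin f (Icc 0 L)) (Icc 0 L)

/-- An absolutely continuous function is differentiable almost everywhere. -/
theorem ae_differentiableWithinAt {L : ℝ} (hL : 0 < L) {f : ℝ → ℂ}
    (hf : AbsolutelyContinuousOnInterval f 0 L) :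
    ∀ᵐ x ∂(volume.restrict (Icc 0 L)), DifferentiableWithinAt ℝ f (Icc 0 L) x := by
  rw [ae_restrict_iff' measurableSet_Icc]
  filter_upwards [hf.boundedVariationOn.ae_differentiableAt_of_mem_uIcc] with x hx hxI
  exact (hx (by rwa [uIcc_of_le hL.le])).differentiableWithinAt

/-- Functions in `H²(0, L)` are differentiable everywhere on `[0, L]`. -/
theorem MemH2.differentiableOn {L : ℝ} (hL : 0 < L) {f : ℝ → ℂ} (hf : MemH2 L f) :
    DifferentiableOn ℝ f (Icc 0 L) := by
  set g := derivWithin f (Icc 0 L) with hg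
  have hgc : ContinuousOn g (Icc 0 L) := by
    have := hf.2.1.continuousOn
    rwa [uIcc_of_le hL.le] at this
  have hG : ∀ x ∈ Icc (0 : ℝ) L,
      HasDerivWithinAt (fun y => ∫ t in (0 : ℝ)..y, g t) (g x) (Icc 0 L) x := by
    intro x hx
    have : Fact (x ∈ Icc (0 : ℝ) L) := ⟨hx⟩
    refine intervalIntegral.integral_hasDerivWithinAt_right ?_ ?_ (hgc x hx)
    · refine (hgc.mono ?_).intervalIntegrable
      rw [uIcc_of_le hx.1]
      exact Icc_subset_Icc_right hx.2
    · exact hgc.stronglyMeasurableAtFilter_nhdsWithin measurableSet_Icc x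
  have hGd : ∀ x ∈ Icc (0 : ℝ) L,
      derivWithin (fun y => ∫ t in (0 : ℝ)..y, g t) (Icc 0 L) x = g x := fun x hx =>
    (hG x hx).derivWithin (uniqueDiffOn_Icc hL x hx)
  have hGac : AbsolutelyContinuousOnInterval (fun y => ∫ t in (0 : ℝ)..y, g t) 0 L := by
    apply ContDiffOn.absolutelyContinuousOnInterval
    rw [uIcc_of_le hL.le, contDiffOn_one_iff_derivWithin (uniqueDiffOn_Icc hL)]
    exact ⟨fun x hx => (hG x hx).differentiableWithinAt, hgc.congr hGd⟩
  obtain ⟨C, hC⟩ := (hf.1.1.sub hGac).const_of_ae_hasDerivAt_zero (by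
    have h0 : ∀ᵐ x : ℝ, x ≠ 0 := by simp [ae_iff, measure_singleton]
    have h1 : ∀ᵐ x : ℝ, x ≠ L := by simp [ae_iff, measure_singleton]
    filter_upwards [hf.1.1.boundedVariationOn.ae_differentiableAt_of_mem_uIcc, h0, h1]
      with x hx hx0 hx1 hxI
    have hd := (hx hxI).hasDerivAt
    rw [uIcc_of_le hL.le] at hxI
    have hn : Icc (0 : ℝ) L ∈ nhds x :=
      Icc_mem_nhds (lt_of_le_of_ne hxI.1 (Ne.symm hx0)) (lt_of_le_of_ne hxI.2 hx1)
    have h2 := hd.sub ((hG x hxI).hasDerivAt hn)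
    rwa [hg, derivWithin_of_mem_nhds hn, sub_self] at h2)
  rw [uIcc_of_le hL.le] at hC
  intro x hx
  refine (((hG x hx).const_add C).differentiableWithinAt).congr (fun y hy => ?_) ?_
  · have := hC y hy
    simp only [Pi.sub_apply] at this
    rw [← this]; ring
  · have := hC x hx
    simp only [Pi.sub_apply] at this
    rw [← this]; ring

theorem derivWithin_congr_Icc {L : ℝ} {f g : ℝ → ℂ} (h : EqOn f g (Icc 0 L)) :
    EqOn (derivWithin f (Icc 0 L)) (derivWithin g (Icc 0 L)) (Icc 0 L) :=
  fun _ hx => derivWithin_congr h (h hx)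

theorem absolutelyContinuous_congr {L : ℝ} (hL : 0 < L) {f g : ℝ → ℂ}
    (h : EqOn f g (Icc 0 L)) (hf : AbsolutelyContinuousOnInterval f 0 L) :
    AbsolutelyContinuousOnInterval g 0 L := by
  rw [absolutelyContinuousOnInterval_iff] at hf ⊢
  intro ε hε
  obtain ⟨δ, hδ, H⟩ := hf ε hε
  refine ⟨δ, hδ, fun E hE hE' => ?_⟩
  have := H E hE hE'
  rw [← uIcc_of_le hL.le] at h
  rwa [Finset.sum_congr rfl (g := fun i => dist (f (E.2 i).1) (f (E.2 i).2))]
  intro i hi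
  rw [h (hE.1 i hi).1, h (hE.1 i hi).2]

theorem derivWithin_add_eqOn {L : ℝ} {f g : ℝ → ℂ}
    (hf : DifferentiableOn ℝ f (Icc 0 L)) (hg : DifferentiableOn ℝ g (Icc 0 L)) :
    EqOn (derivWithin (f + g) (Icc 0 L))
      (derivWithin f (Icc 0 L) + derivWithin g (Icc 0 L)) (Icc 0 L) :=
  fun x hx => derivWithin_add (hf x hx) (hg x hx)

theorem derivWithin_smul_eqOn {L : ℝ} (c : ℂ) {f : ℝ → ℂ}
    (hf : DifferentiableOn ℝ f (Icc 0 L)) :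
    EqOn (derivWithin (c • f) (Icc 0 L)) (c • derivWithin f (Icc 0 L)) (Icc 0 L) :=
  fun x hx => derivWithin_const_smul c (hf x hx)

theorem secondDeriv_add {L : ℝ} (hL : 0 < L) {f g : ℝ → ℂ} (hf : MemH2 L f) (hg : MemH2 L g) :
    secondDeriv L (f + g) =ᵐ[volume.restrict (Icc 0 L)] secondDeriv L f + secondDeriv L g := by
  filter_upwards [ae_differentiableWithinAt hL hf.2.1, ae_differentiableWithinAt hL hg.2.1,
    ae_restrict_mem measurableSet_Icc] with x h1 h2 hx
  have h := derivWithin_congr_Icc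
    (derivWithin_add_eqOn (hf.differentiableOn hL) (hg.differentiableOn hL)) hx
  simp only [secondDeriv, Pi.add_apply]
  rw [h]
  exact derivWithin_add h1 h2

theorem secondDeriv_smul {L : ℝ} (hL : 0 < L) (c : ℂ) {f : ℝ → ℂ} (hf : MemH2 L f) :
    secondDeriv L (c • f) =ᵐ[volume.restrict (Icc 0 L)] c • secondDeriv L f := by
  filter_upwards [ae_differentiableWithinAt hL hf.2.1,
    ae_restrict_mem measurableSet_Icc] with x h1 hx
  have h := derivWithin_congr_Icc (derivWithin_smul_eqOn c (hf.differentiableOn hL)) hx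
  simp only [secondDeriv, Pi.smul_apply]
  rw [h]
  exact derivWithin_const_smul c h1

theorem MemH2.add {L : ℝ} (hL : 0 < L) {f g : ℝ → ℂ} (hf : MemH2 L f) (hg : MemH2 L g) :
    MemH2 L (f + g) := by
  have h := derivWithin_add_eqOn (hf.differentiableOn hL) (hg.differentiableOn hL)
  refine ⟨⟨hf.1.1.add hg.1.1, (hf.1.2.add hg.1.2).ae_eq ?_⟩,
    absolutelyContinuous_congr hL h.symm (hf.2.1.add hg.2.1), (hf.2.2.add hg.2.2).ae_eq ?_⟩
  · filter_upwards [ae_restrict_mem measurableSet_Icc] with x hx using (h hx).symm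
  · exact (secondDeriv_add hL hf hg).symm

theorem MemH2.smul {L : ℝ} (hL : 0 < L) (c : ℂ) {f : ℝ → ℂ} (hf : MemH2 L f) :
    MemH2 L (c • f) := by
  have h := derivWithin_smul_eqOn c (hf.differentiableOn hL)
  refine ⟨⟨hf.1.1.const_smul c, (hf.1.2.const_smul c).ae_eq ?_⟩,
    absolutelyContinuous_congr hL h.symm (hf.2.1.const_smul c), (hf.2.2.const_smul c).ae_eq ?_⟩
  · filter_upwards [ae_restrict_mem measurableSet_Icc] with x hx using (h hx).symm
  · exact (secondDeriv_smul hL c hf).symm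

theorem absolutelyContinuous_zero (L : ℝ) :
    AbsolutelyContinuousOnInterval (0 : ℝ → ℂ) 0 L := by
  rw [absolutelyContinuousOnInterval_iff]
  exact fun ε hε => ⟨1, one_pos, fun E _ _ => by simpa using hε⟩

theorem derivWithin_zero_fun (L : ℝ) : derivWithin (0 : ℝ → ℂ) (Icc 0 L) = 0 :=
  derivWithin_const (Icc 0 L) (0 : ℂ)

theorem MemH2.zero (L : ℝ) : MemH2 L 0 := by
  refine ⟨⟨absolutelyContinuous_zero L, ?_⟩, ?_, ?_⟩ <;>
    simp only [derivWithin_zero_fun]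
  · exact MemLp.zero
  · exact absolutelyContinuous_zero L
  · exact MemLp.zero

theorem secondDeriv_zero (L : ℝ) : secondDeriv L 0 = 0 := by
  simp [secondDeriv]

/-- A function in `H²(0, L)` that vanishes almost everywhere has vanishing second derivative. -/
theorem secondDeriv_eq_zero {L : ℝ} (hL : 0 < L) {f : ℝ → ℂ} (hf : MemH2 L f)
    (h0 : f =ᵐ[volume.restrict (Icc 0 L)] 0) : EqOn (secondDeriv L f) 0 (Icc 0 L) := by
  have hc : ContinuousOn f (Icc 0 L) := by
    have := hf.1.1.continuousOn
    rwa [uIcc_of_le hL.le] at this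
  have h : EqOn f 0 (Icc 0 L) :=
    Measure.eqOn_Icc_of_ae_eq volume hL.ne h0 hc continuousOn_const
  intro x hx
  have := derivWithin_congr_Icc (derivWithin_congr_Icc h) hx
  rw [secondDeriv, this]
  simp

/-! ### Metric graphs -/

variable {V : Type*} {G : SimpleGraph V}

/-- An assignment of a direction to every edge of a graph. -/
structure Orientation (G : SimpleGraph V) where
  tail : G.edgeSet → V
  head : G.edgeSet → V
  mk_eq : ∀ e, s(tail e, head e) = e.1

instance : Nonempty (Orientation G) :=
  ⟨⟨fun e => (Quot.out e.1).1, fun e => (Quot.out e.1).2, fun e => Quot.out_eq e.1⟩⟩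

/-- The Hilbert space `L²(𝒢) = ⨁ₑ L²(e)` of the metric graph with edge lengths `ℓ`, where the
edge `e` is identified with the interval `[0, ℓ e]`. -/
abbrev L2 (G : SimpleGraph V) (ℓ : G.edgeSet → ℝ) : Type _ :=
  lp (fun e : G.edgeSet => Lp ℂ 2 (volume.restrict (Icc 0 (ℓ e)))) 2

/-- The subspace `L²_c(𝒢)` of the functions that vanish on all but finitely many edges. -/
def L2c (G : SimpleGraph V) (ℓ : G.edgeSet → ℝ) : Submodule ℂ (L2 G ℓ) where
  carrier := {u | {e | u e ≠ 0}.Finite}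
  zero_mem' := by simp
  add_mem' {u v} hu hv := by
    refine (Set.Finite.union hu hv).subset fun e he => ?_
    by_contra h
    simp only [mem_union, mem_ofPred_eq, not_or, not_not] at h
    exact he (by simp [h.1, h.2])
  smul_mem' c u hu := by
    refine Set.Finite.subset hu fun e he h => he ?_
    simp [h]

open scoped Classical in
/-- The value `f_e(v)` at an endpoint `v` of the edge `e`. The tail of `e` is the left endpoint
of `[0, ℓ e]` and the head is the right endpoint. -/
def vertexValue (o : Orientation G) (ℓ : G.edgeSet → ℝ) (f : G.edgeSet → ℝ → ℂ)
    (e : G.edgeSet) (v : V) : ℂ :=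
  if v = o.tail e then f e 0 else f e (ℓ e)

open scoped Classical in
/-- The derivative `f_e'(v)` at an endpoint `v` of the edge `e`, in the direction pointing from
`v` into the edge. -/
def vertexDeriv (o : Orientation G) (ℓ : G.edgeSet → ℝ) (f : G.edgeSet → ℝ → ℂ)
    (e : G.edgeSet) (v : V) : ℂ :=
  if v = o.tail e then derivWithin (f e) (Icc 0 (ℓ e)) 0
  else -derivWithin (f e) (Icc 0 (ℓ e)) (ℓ e)

/-- The edge joining `v` to a neighbour `w`. -/
def starEdge (v : V) (w : G.neighborSet v) : G.edgeSet := ⟨s(v, w.1), w.2⟩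

/-- The Kirchhoff conditions at the vertex `v`: `f` is continuous at `v`, and the outgoing
derivatives along the edges incident to `v` sum up to zero. -/
def Kirchhoff [G.LocallyFinite] (o : Orientation G) (ℓ : G.edgeSet → ℝ)
    (f : G.edgeSet → ℝ → ℂ) (v : V) : Prop :=
  (∀ w w' : G.neighborSet v,
    vertexValue o ℓ f (starEdge v w) v = vertexValue o ℓ f (starEdge v w') v) ∧
  ∑ w : G.neighborSet v, vertexDeriv o ℓ f (starEdge v w) v = 0

theorem vertexValue_add (o : Orientation G) (ℓ : G.edgeSet → ℝ) (f g : G.edgeSet → ℝ → ℂ)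
    (e : G.edgeSet) (v : V) :
    vertexValue o ℓ (f + g) e v = vertexValue o ℓ f e v + vertexValue o ℓ g e v := by
  unfold vertexValue; split_ifs <;> rfl

theorem vertexValue_smul (o : Orientation G) (ℓ : G.edgeSet → ℝ) (c : ℂ)
    (f : G.edgeSet → ℝ → ℂ) (e : G.edgeSet) (v : V) :
    vertexValue o ℓ (c • f) e v = c * vertexValue o ℓ f e v := by
  unfold vertexValue; split_ifs <;> rfl

theorem vertexDeriv_add (o : Orientation G) {ℓ : G.edgeSet → ℝ} (hℓ : ∀ e, 0 < ℓ e)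
    {f g : G.edgeSet → ℝ → ℂ} (hf : ∀ e, MemH2 (ℓ e) (f e)) (hg : ∀ e, MemH2 (ℓ e) (g e))
    (e : G.edgeSet) (v : V) :
    vertexDeriv o ℓ (f + g) e v = vertexDeriv o ℓ f e v + vertexDeriv o ℓ g e v := by
  have h := derivWithin_add_eqOn ((hf e).differentiableOn (hℓ e))
    ((hg e).differentiableOn (hℓ e))
  have h0 := h (left_mem_Icc.2 (hℓ e).le)
  have h1 := h (right_mem_Icc.2 (hℓ e).le)
  unfold vertexDeriv
  simp only [Pi.add_apply] at h0 h1 ⊢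
  split_ifs
  · exact h0
  · rw [h1]; ring

theorem vertexDeriv_smul (o : Orientation G) {ℓ : G.edgeSet → ℝ} (hℓ : ∀ e, 0 < ℓ e) (c : ℂ)
    {f : G.edgeSet → ℝ → ℂ} (hf : ∀ e, MemH2 (ℓ e) (f e)) (e : G.edgeSet) (v : V) :
    vertexDeriv o ℓ (c • f) e v = c * vertexDeriv o ℓ f e v := by
  have h := derivWithin_smul_eqOn c ((hf e).differentiableOn (hℓ e))
  have h0 := h (left_mem_Icc.2 (hℓ e).le)
  have h1 := h (right_mem_Icc.2 (hℓ e).le)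
  unfold vertexDeriv
  simp only [Pi.smul_apply, smul_eq_mul] at h0 h1 ⊢
  split_ifs
  · exact h0
  · rw [h1]; ring

theorem Kirchhoff.add [G.LocallyFinite] {o : Orientation G} {ℓ : G.edgeSet → ℝ}
    (hℓ : ∀ e, 0 < ℓ e) {f g : G.edgeSet → ℝ → ℂ} (hf : ∀ e, MemH2 (ℓ e) (f e))
    (hg : ∀ e, MemH2 (ℓ e) (g e)) {v : V} (kf : Kirchhoff o ℓ f v) (kg : Kirchhoff o ℓ g v) :
    Kirchhoff o ℓ (f + g) v := by
  refine ⟨fun w w' => ?_, ?_⟩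
  · rw [vertexValue_add, vertexValue_add, kf.1 w w', kg.1 w w']
  · simp only [vertexDeriv_add o hℓ hf hg, Finset.sum_add_distrib, kf.2, kg.2, add_zero]

theorem Kirchhoff.smul [G.LocallyFinite] {o : Orientation G} {ℓ : G.edgeSet → ℝ}
    (hℓ : ∀ e, 0 < ℓ e) (c : ℂ) {f : G.edgeSet → ℝ → ℂ} (hf : ∀ e, MemH2 (ℓ e) (f e))
    {v : V} (kf : Kirchhoff o ℓ f v) : Kirchhoff o ℓ (c • f) v := by
  refine ⟨fun w w' => ?_, ?_⟩
  · rw [vertexValue_smul, vertexValue_smul, kf.1 w w']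
  · simp only [vertexDeriv_smul o hℓ c hf, ← Finset.mul_sum, kf.2, mul_zero]

theorem Kirchhoff.zero [G.LocallyFinite] (o : Orientation G) (ℓ : G.edgeSet → ℝ) (v : V) :
    Kirchhoff o ℓ 0 v := by
  refine ⟨fun w w' => ?_, ?_⟩
  · simp [vertexValue]
  · simp [vertexDeriv]

/-! ### The Kirchhoff Laplacian -/

/-- The graph of the maximal Kirchhoff Laplacian: the pairs `(u, w)` in `L²(𝒢) × L²(𝒢)` such that
`u` has a representative `f` that is in `H²` on every edge and satisfies the Kirchhoff conditions
at every vertex, and `w = -f''` on every edge. -/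
def laplacianGraph [G.LocallyFinite] (o : Orientation G) {ℓ : G.edgeSet → ℝ}
    (hℓ : ∀ e, 0 < ℓ e) : Submodule ℂ (L2 G ℓ × L2 G ℓ) where
  carrier := {p | ∃ f : G.edgeSet → ℝ → ℂ, (∀ e, MemH2 (ℓ e) (f e)) ∧
    (∀ v, Kirchhoff o ℓ f v) ∧
    (∀ e, p.1 e =ᵐ[volume.restrict (Icc 0 (ℓ e))] f e) ∧
    ∀ e, p.2 e =ᵐ[volume.restrict (Icc 0 (ℓ e))] -secondDeriv (ℓ e) (f e)}
  zero_mem' := by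
    refine ⟨0, fun e => MemH2.zero _, Kirchhoff.zero o ℓ, fun e => ?_, fun e => ?_⟩
    · exact Lp.coeFn_zero _ _ _
    · simp only [Pi.zero_apply, secondDeriv_zero, neg_zero]
      exact Lp.coeFn_zero _ _ _
  add_mem' := by
    rintro ⟨u, w⟩ ⟨u', w'⟩ ⟨f, hf, kf, h1, h2⟩ ⟨f', hf', kf', h1', h2'⟩
    refine ⟨f + f', fun e => (hf e).add (hℓ e) (hf' e), fun v => (kf v).add hℓ hf hf' (kf' v),
      fun e => ?_, fun e => ?_⟩
    · exact (Lp.coeFn_add (u e) (u' e)).trans ((h1 e).add (h1' e))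
    · refine (Lp.coeFn_add (w e) (w' e)).trans (((h2 e).add (h2' e)).trans ?_)
      filter_upwards [secondDeriv_add (hℓ e) (hf e) (hf' e)] with x hx
      simp only [Pi.add_apply, Pi.neg_apply] at hx ⊢
      rw [hx]; ring
  smul_mem' := by
    rintro c ⟨u, w⟩ ⟨f, hf, kf, h1, h2⟩
    refine ⟨c • f, fun e => (hf e).smul (hℓ e) c, fun v => (kf v).smul hℓ c hf,
      fun e => ?_, fun e => ?_⟩
    · exact (Lp.coeFn_smul c (u e)).trans ((h1 e).const_smul c)
    · refine (Lp.coeFn_smul c (w e)).trans (((h2 e).const_smul c).trans ?_)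
      filter_upwards [secondDeriv_smul (hℓ e) c (hf e)] with x hx
      simp only [Pi.smul_apply, Pi.neg_apply, smul_eq_mul] at hx ⊢
      rw [hx]; ring

/-- The maximal Kirchhoff Laplacian `H` in `L²(𝒢)`. -/
def maximalLaplacian [G.LocallyFinite] (o : Orientation G) {ℓ : G.edgeSet → ℝ}
    (hℓ : ∀ e, 0 < ℓ e) : L2 G ℓ →ₗ.[ℂ] L2 G ℓ :=
  (laplacianGraph o hℓ).toLinearPMap

/-- `laplacianGraph` is single-valued, so it is indeed the graph of `maximalLaplacian`. -/
theorem maximalLaplacian_graph [G.LocallyFinite] (o : Orientation G) {ℓ : G.edgeSet → ℝ}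
    (hℓ : ∀ e, 0 < ℓ e) : (maximalLaplacian o hℓ).graph = laplacianGraph o hℓ := by
  refine Submodule.toLinearPMap_graph_eq _ ?_
  rintro ⟨u, w⟩ ⟨f, hf, -, h1, h2⟩ (rfl : u = 0)
  refine lp.ext (funext fun e => Lp.ext ?_)
  have h0 : f e =ᵐ[volume.restrict (Icc 0 (ℓ e))] 0 :=
    (h1 e).symm.trans (Lp.coeFn_zero _ _ _)
  refine (h2 e).trans (Filter.EventuallyEq.trans ?_ (Lp.coeFn_zero _ _ _).symm)
  filter_upwards [ae_restrict_mem measurableSet_Icc] with x hx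
  simp [secondDeriv_eq_zero (hℓ e) (hf e) h0 hx]

/-- The pre-minimal Kirchhoff Laplacian `H₀⁰`, the restriction of `H` to the functions that vanish
on all but finitely many edges. -/
def preminimalLaplacian [G.LocallyFinite] (o : Orientation G) {ℓ : G.edgeSet → ℝ}
    (hℓ : ∀ e, 0 < ℓ e) : L2 G ℓ →ₗ.[ℂ] L2 G ℓ :=
  (maximalLaplacian o hℓ).domRestrict (L2c G ℓ)

/-- The minimal Kirchhoff Laplacian `H₀`, the closure of `H₀⁰` in `L²(𝒢)`. -/
def minimalLaplacian [G.LocallyFinite] (o : Orientation G) {ℓ : G.edgeSet → ℝ}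
    (hℓ : ∀ e, 0 < ℓ e) : L2 G ℓ →ₗ.[ℂ] L2 G ℓ :=
  (preminimalLaplacian o hℓ).closure

/-! ### Deficiency indices -/

/-- The deficiency subspace `ker (T* - z)`, the set of the `g` with `T* g = z g`. -/
def deficiencySubspace {H : Type*} [NormedAddCommGroup H] [InnerProductSpace ℂ H]
    [CompleteSpace H] (T : H →ₗ.[ℂ] H) (z : ℂ) : Submodule ℂ H :=
  T.adjoint.graph.comap (LinearMap.id.prod (z • LinearMap.id))

/-- `dim ker (T* - z)` as an element of `ℕ ∪ {∞}`. The deficiency indices `n₊(T)` and `n₋(T)` are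
its values at `z = i` and `z = -i`. -/
def defect {H : Type*} [NormedAddCommGroup H] [InnerProductSpace ℂ H]
    [CompleteSpace H] (T : H →ₗ.[ℂ] H) (z : ℂ) : ℕ∞ :=
  Cardinal.toENat (Module.rank ℂ (deficiencySubspace T z))

/-! ### Antitrees -/

/-- The antitree with sphere numbers `s 0 = 1, s 1, s 2, …`: the combinatorial sphere `Sₙ` consists
of the `s n` vertices `⟨n, i⟩`, and two vertices are adjacent exactly when they lie in consecutive
spheres. -/
def antitree (s : ℕ → ℕ) : SimpleGraph (Σ n, Fin (s n)) where
  Adj x y := x.1 + 1 = y.1 ∨ y.1 + 1 = x.1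
  symm := ⟨fun _ _ h => h.symm⟩
  loopless := ⟨fun x h => by omega⟩

instance (s : ℕ → ℕ) : (antitree s).LocallyFinite := fun x => by
  refine Set.Finite.fintype (Set.Finite.subset
    (((Finset.range (x.1 + 2)).sigma fun n => (Finset.univ : Finset (Fin (s n)))).finite_toSet) ?_)
  rintro ⟨m, i⟩ (h : x.1 + 1 = m ∨ m + 1 = x.1)
  simp only [Finset.mem_coe, Finset.mem_sigma, Finset.mem_range, Finset.mem_univ, and_true]
  omega

end QuantumGraph

end

/-!
The adjoint of `H₀` is the maximal Kirchhoff Laplacian: testing against functions supported in one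
edge gives `f ∈ H²(e)` on every edge `e`, and testing against Hermite polynomials on the star of a
vertex gives the Kirchhoff conditions. For `κ² = -z` the deficiency subspace of `H₀` at `z` hence
consists of the square integrable solutions of `f'' = κ² f` with Kirchhoff conditions, and such an
`f` is determined by its vertex values, which satisfy a second order difference equation.

Choose a partition of the labels `0, 1, 2, …` of the vertices in the spheres into `N` classes, and
let an edge of level `k` have length `10^(-6 (k + 1))`, or the square of it if the labels of its
endpoints are in the same class. For short edges the difference equation is dominated by the edges
inside the classes. The equation on the `n`-th sphere forces the values there to be constant on
classes, and determines the values on the next sphere, up to one free value if a new class occurs on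
it. So the solutions have `N` degrees of freedom. They grow at most by a factor `100` from one
sphere to the next, and the decay of the edge lengths makes them square integrable.
-/

noncomputable section

namespace QuantumGraph

open scoped InnerProductSpace

/-! ### Calculus in `H²(0, L)` -/

section Interval

variable {L : ℝ} {f g f₁ f₂ w : ℝ → ℂ}

theorem absolutelyContinuous_integral (hL : 0 < L) (hf : IntervalIntegrable f volume 0 L) :
    AbsolutelyContinuousOnInterval (fun x => ∫ t in (0 : ℝ)..x, f t) 0 L := by
  have ofReal {h : ℝ → ℝ} (hh : AbsolutelyContinuousOnInterval h 0 L) :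
      AbsolutelyContinuousOnInterval (fun x => (h x : ℂ)) 0 L := by
    rw [absolutelyContinuousOnInterval_iff] at hh ⊢
    simpa only [Complex.dist_of_im_eq, Complex.ofReal_im, Complex.ofReal_re] using hh
  have hre : IntervalIntegrable (fun t => (f t).re) volume 0 L := ⟨hf.1.re, hf.2.re⟩
  have him : IntervalIntegrable (fun t => (f t).im) volume 0 L := ⟨hf.1.im, hf.2.im⟩
  refine absolutelyContinuous_congr hL (fun x hx => ?_)
    ((ofReal (hre.absolutelyContinuousOnInterval_intervalIntegral left_mem_uIcc)).add
      ((ofReal (him.absolutelyContinuousOnInterval_intervalIntegral left_mem_uIcc)).const_smul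
        Complex.I))
  have hx : IntervalIntegrable f volume 0 x :=
    hf.mono_set (uIcc_subset_uIcc left_mem_uIcc (by rwa [uIcc_of_le hL.le]))
  have e1 : ∫ t in (0 : ℝ)..x, (f t).re = (∫ t in (0 : ℝ)..x, f t).re :=
    Complex.reCLM.intervalIntegral_comp_comm hx
  have e2 : ∫ t in (0 : ℝ)..x, (f t).im = (∫ t in (0 : ℝ)..x, f t).im :=
    Complex.imCLM.intervalIntegral_comp_comm hx
  simp only [Pi.add_apply, smul_eq_mul, e1, e2]
  rw [mul_comm, Complex.re_add_im]

theorem integral_eq_sub_of_absolutelyContinuous (hL : 0 < L)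
    (hf : AbsolutelyContinuousOnInterval f 0 L)
    (hd : ∀ᵐ x ∂volume.restrict (Icc 0 L), HasDerivAt f (f₁ x) x)
    (hi : IntegrableOn f₁ (Icc 0 L)) : ∫ x in Icc 0 L, f₁ x = f L - f 0 := by
  have hi' : IntervalIntegrable f₁ volume 0 L :=
    (intervalIntegrable_iff_integrableOn_Icc_of_le hL.le).2 hi
  rw [ae_restrict_iff' measurableSet_Icc] at hd
  obtain ⟨C, hC⟩ :=
    (hf.sub (absolutelyContinuous_integral hL hi')).const_of_ae_hasDerivAt_zero (by
      filter_upwards [hd, hi'.ae_hasDerivAt_integral] with x h1 h2 hx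
      simpa using (h1 (by rwa [uIcc_of_le hL.le] at hx)).sub (h2 hx 0 left_mem_uIcc))
  have h0 := hC 0 left_mem_uIcc
  have h1 := hC L right_mem_uIcc
  simp only [Pi.sub_apply, intervalIntegral.integral_same, sub_zero] at h0 h1
  rw [integral_Icc_eq_integral_Ioc, ← intervalIntegral.integral_of_le hL.le, h0, ← h1]
  ring

theorem absolutelyContinuous_of_hasDerivWithinAt (hL : 0 < L)
    (h : ∀ x ∈ Icc 0 L, HasDerivWithinAt f (f₁ x) (Icc 0 L) x)
    (hc : ContinuousOn f₁ (Icc 0 L)) : AbsolutelyContinuousOnInterval f 0 L := by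
  apply ContDiffOn.absolutelyContinuousOnInterval
  rw [uIcc_of_le hL.le, contDiffOn_one_iff_derivWithin (uniqueDiffOn_Icc hL)]
  exact ⟨fun x hx => (h x hx).differentiableWithinAt,
    hc.congr fun x hx => (h x hx).derivWithin (uniqueDiffOn_Icc hL x hx)⟩

theorem continuousOn_of_absolutelyContinuous (hL : 0 < L)
    (hf : AbsolutelyContinuousOnInterval f 0 L) : ContinuousOn f (Icc 0 L) := by
  have := hf.continuousOn
  rwa [uIcc_of_le hL.le] at this

theorem memLp_of_continuousOn {p : ENNReal} (hf : ContinuousOn f (Icc 0 L)) :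
    MemLp f p (volume.restrict (Icc 0 L)) := by
  obtain ⟨C, hC⟩ := isCompact_Icc.exists_bound_of_continuousOn hf
  exact MemLp.of_bound (hf.aestronglyMeasurable measurableSet_Icc) C
    ((ae_restrict_iff' measurableSet_Icc).2 (Filter.Eventually.of_forall hC))

theorem ae_mem_Ioo (L : ℝ) : ∀ᵐ x ∂(volume.restrict (Icc (0 : ℝ) L)), x ∈ Ioo 0 L := by
  rw [← Measure.restrict_congr_set Ioo_ae_eq_Icc]
  exact ae_restrict_mem measurableSet_Ioo

theorem ae_hasDerivAt_of_absolutelyContinuous (hL : 0 < L)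
    (hf : AbsolutelyContinuousOnInterval f 0 L) :
    ∀ᵐ x ∂(volume.restrict (Icc 0 L)), HasDerivAt f (derivWithin f (Icc 0 L) x) x := by
  filter_upwards [ae_differentiableWithinAt hL hf, ae_mem_Ioo L] with x hd hx
  exact hd.hasDerivWithinAt.hasDerivAt (Icc_mem_nhds hx.1 hx.2)

theorem derivWithin_eqOn (hL : 0 < L) (h : ∀ x ∈ Icc 0 L, HasDerivWithinAt f (f₁ x) (Icc 0 L) x) :
    EqOn (derivWithin f (Icc 0 L)) f₁ (Icc 0 L) :=
  fun x hx => (h x hx).derivWithin (uniqueDiffOn_Icc hL x hx)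

theorem secondDeriv_ae_eq (hL : 0 < L)
    (h : ∀ x ∈ Icc 0 L, HasDerivWithinAt f (f₁ x) (Icc 0 L) x)
    (h₂ : ∀ᵐ x ∂(volume.restrict (Icc 0 L)), HasDerivAt f₁ (f₂ x) x) :
    secondDeriv L f =ᵐ[volume.restrict (Icc 0 L)] f₂ := by
  filter_upwards [h₂, ae_restrict_mem measurableSet_Icc] with x h2 hx
  rw [secondDeriv, derivWithin_congr_Icc (derivWithin_eqOn hL h) hx]
  exact h2.hasDerivWithinAt.derivWithin (uniqueDiffOn_Icc hL x hx)

theorem MemH2.of_hasDeriv (hL : 0 < L)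
    (h : ∀ x ∈ Icc 0 L, HasDerivWithinAt f (f₁ x) (Icc 0 L) x)
    (h₁ : AbsolutelyContinuousOnInterval f₁ 0 L)
    (h₂ : ∀ᵐ x ∂(volume.restrict (Icc 0 L)), HasDerivAt f₁ (f₂ x) x)
    (hm : MemLp f₂ 2 (volume.restrict (Icc 0 L))) : MemH2 L f := by
  have hd := derivWithin_eqOn hL h
  have hc := continuousOn_of_absolutelyContinuous hL h₁
  refine ⟨⟨absolutelyContinuous_of_hasDerivWithinAt hL h hc, (memLp_of_continuousOn hc).ae_eq ?_⟩,
    absolutelyContinuous_congr hL hd.symm h₁, hm.ae_eq (secondDeriv_ae_eq hL h h₂).symm⟩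
  filter_upwards [ae_restrict_mem measurableSet_Icc] with x hx using (hd hx).symm

theorem MemH2.of_contDiff (hL : 0 < L) (h : ∀ x, HasDerivAt f (f₁ x) x)
    (h₁ : ∀ x, HasDerivAt f₁ (f₂ x) x) (hc : Continuous f₂) : MemH2 L f :=
  MemH2.of_hasDeriv hL (fun x _ => (h x).hasDerivWithinAt)
    (absolutelyContinuous_of_hasDerivWithinAt hL (fun x _ => (h₁ x).hasDerivWithinAt)
      hc.continuousOn)
    (Filter.Eventually.of_forall h₁) (memLp_of_continuousOn hc.continuousOn)

theorem MemH2.continuousOn (hL : 0 < L) (hf : MemH2 L f) : ContinuousOn f (Icc 0 L) :=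
  continuousOn_of_absolutelyContinuous hL hf.1.1

theorem memH2_star (hL : 0 < L) (hf : MemH2 L f) : MemH2 L (star f) := by
  have ac_star {h : ℝ → ℂ} (hh : AbsolutelyContinuousOnInterval h 0 L) :
      AbsolutelyContinuousOnInterval (star h) 0 L := by
    rw [absolutelyContinuousOnInterval_iff] at hh ⊢
    simpa only [Pi.star_apply, dist_star_star] using hh
  refine MemH2.of_hasDeriv hL (f₁ := star (derivWithin f (Icc 0 L))) (f₂ := star (secondDeriv L f))
    (fun x hx => (hf.differentiableOn hL x hx).hasDerivWithinAt.star) (ac_star hf.2.1) ?_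
    hf.2.2.star
  filter_upwards [ae_hasDerivAt_of_absolutelyContinuous hL hf.2.1] with x hx using hx.star

theorem MemH2.integral_mul_secondDeriv_sub (hL : 0 < L) (hf : MemH2 L f) (hg : MemH2 L g) :
    ∫ x in Icc 0 L, (g x * secondDeriv L f x - secondDeriv L g x * f x) =
      (g L * derivWithin f (Icc 0 L) L - derivWithin g (Icc 0 L) L * f L) -
      (g 0 * derivWithin f (Icc 0 L) 0 - derivWithin g (Icc 0 L) 0 * f 0) := by
  refine integral_eq_sub_of_absolutelyContinuous hL
    (f := fun x => g x * derivWithin f (Icc 0 L) x - derivWithin g (Icc 0 L) x * f x)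
    ((hg.1.1.smul hf.2.1).sub (hg.2.1.smul hf.1.1)) ?_ ?_
  · filter_upwards [ae_hasDerivAt_of_absolutelyContinuous hL hf.1.1,
      ae_hasDerivAt_of_absolutelyContinuous hL hf.2.1,
      ae_hasDerivAt_of_absolutelyContinuous hL hg.1.1,
      ae_hasDerivAt_of_absolutelyContinuous hL hg.2.1] with x hf₁ hf₂ hg₁ hg₂
    refine ((hg₁.mul hf₂).sub (hg₂.mul hf₁)).congr_deriv ?_
    rw [secondDeriv, secondDeriv]
    ring
  · have hfm : MemLp f 2 _ := memLp_of_continuousOn (hf.continuousOn hL)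
    have hgm : MemLp g 2 _ := memLp_of_continuousOn (hg.continuousOn hL)
    exact (hgm.integrable_mul hf.2.2).sub (hg.2.2.integrable_mul hfm)

theorem hasDerivWithinAt_integral (hf : ContinuousOn f (Icc 0 L)) {x : ℝ} (hx : x ∈ Icc 0 L) :
    HasDerivWithinAt (fun y => ∫ t in (0 : ℝ)..y, f t) (f x) (Icc 0 L) x := by
  have : Fact (x ∈ Icc (0 : ℝ) L) := ⟨hx⟩
  refine intervalIntegral.integral_hasDerivWithinAt_right ?_
    (hf.stronglyMeasurableAtFilter_nhdsWithin measurableSet_Icc x) (hf x hx)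
  refine (hf.mono ?_).intervalIntegrable
  rw [uIcc_of_le hx.1]
  exact Icc_subset_Icc_right hx.2

theorem exists_memH2_secondDeriv_ae_eq (hL : 0 < L)
    (hw : MemLp w 2 (volume.restrict (Icc 0 L))) :
    ∃ f, MemH2 L f ∧ f 0 = 0 ∧ derivWithin f (Icc 0 L) 0 = 0 ∧
      secondDeriv L f =ᵐ[volume.restrict (Icc 0 L)] w := by
  have hi : IntervalIntegrable w volume 0 L :=
    (intervalIntegrable_iff_integrableOn_Icc_of_le hL.le).2 (hw.integrable one_le_two)
  set w₁ : ℝ → ℂ := fun x => ∫ t in (0 : ℝ)..x, w t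
  have hw₁ : AbsolutelyContinuousOnInterval w₁ 0 L := absolutelyContinuous_integral hL hi
  have hd (x) (hx : x ∈ Icc 0 L) :
      HasDerivWithinAt (fun y => ∫ t in (0 : ℝ)..y, w₁ t) (w₁ x) (Icc 0 L) x :=
    hasDerivWithinAt_integral (continuousOn_of_absolutelyContinuous hL hw₁) hx
  have hd₂ : ∀ᵐ x ∂(volume.restrict (Icc 0 L)), HasDerivAt w₁ (w x) x := by
    rw [ae_restrict_iff' measurableSet_Icc, ← uIcc_of_le hL.le]
    filter_upwards [hi.ae_hasDerivAt_integral] with x hx hxI using hx hxI 0 left_mem_uIcc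
  refine ⟨_, MemH2.of_hasDeriv hL hd hw₁ hd₂ hw, intervalIntegral.integral_same, ?_,
    secondDeriv_ae_eq hL hd hd₂⟩
  rw [derivWithin_eqOn hL hd (left_mem_Icc.2 hL.le)]
  exact intervalIntegral.integral_same

/-! ### The Laplacian on an edge -/

variable {u v φ ψ : Lp ℂ 2 (volume.restrict (Icc 0 L))}

/-- `(u, v)` lies in the graph of the maximal operator `f ↦ -f''` in `L²(0, L)`, and `f` is the
representative of `u` in `H²(0, L)`. -/
structure IsH2Rep (L : ℝ) (f : ℝ → ℂ) (u v : Lp ℂ 2 (volume.restrict (Icc 0 L))) : Prop where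
  memH2 : MemH2 L f
  fst_ae_eq : u =ᵐ[volume.restrict (Icc 0 L)] f
  snd_ae_eq : v =ᵐ[volume.restrict (Icc 0 L)] -secondDeriv L f

theorem MemH2.exists_isH2Rep (hL : 0 < L) (hf : MemH2 L f) : ∃ u v, IsH2Rep L f u v := by
  have hfm : MemLp f 2 (volume.restrict (Icc 0 L)) := memLp_of_continuousOn (hf.continuousOn hL)
  exact ⟨hfm.toLp f, hf.2.2.neg.toLp _, hf, hfm.coeFn_toLp, hf.2.2.neg.coeFn_toLp⟩

/-- The Cauchy data of `f` vanish at both ends of `[0, L]`. -/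
structure ZeroCauchyData (L : ℝ) (f : ℝ → ℂ) : Prop where
  left : f 0 = 0
  deriv_left : derivWithin f (Icc 0 L) 0 = 0
  right : f L = 0
  deriv_right : derivWithin f (Icc 0 L) L = 0

/-- The boundary term of Green's formula on `[0, L]`. -/
def lagrangeBracket (L : ℝ) (g f : ℝ → ℂ) (x : ℝ) : ℂ :=
  ⟪g x, derivWithin f (Icc 0 L) x⟫_ℂ - ⟪derivWithin g (Icc 0 L) x, f x⟫_ℂ

theorem IsH2Rep.inner_sub_inner (hL : 0 < L) (hf : IsH2Rep L f u v) (hg : IsH2Rep L g φ ψ) :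
    ⟪ψ, u⟫_ℂ - ⟪φ, v⟫_ℂ = lagrangeBracket L g f L - lagrangeBracket L g f 0 := by
  have hstar := memH2_star hL hg.memH2
  have hd : EqOn (derivWithin (star g) (Icc 0 L)) (star (derivWithin g (Icc 0 L))) (Icc 0 L) :=
    fun _ _ => derivWithin.star
  have hgreen := hf.memH2.integral_mul_secondDeriv_sub hL hstar
  have hint : ⟪ψ, u⟫_ℂ - ⟪φ, v⟫_ℂ =
      ∫ x in Icc 0 L, (star g x * secondDeriv L f x - secondDeriv L (star g) x * f x) := by
    rw [L2.inner_def, L2.inner_def, ← integral_sub (L2.integrable_inner _ _)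
      (L2.integrable_inner _ _)]
    refine integral_congr_ae ?_
    filter_upwards [hf.fst_ae_eq, hf.snd_ae_eq, hg.fst_ae_eq, hg.snd_ae_eq,
      ae_restrict_mem measurableSet_Icc] with x hu hv hφ hψ hx
    have hd₂ : secondDeriv L (star g) x = star (secondDeriv L g x) := by
      rw [secondDeriv, derivWithin_congr_Icc hd hx]
      exact derivWithin.star
    simp only [hu, hv, hφ, hψ, hd₂, RCLike.inner_apply, Pi.neg_apply, Pi.star_apply, map_neg,
      RCLike.star_def]
    ring
  rw [hint, hgreen, hd (left_mem_Icc.2 hL.le), hd (right_mem_Icc.2 hL.le)]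
  simp only [lagrangeBracket, RCLike.inner_apply, Pi.star_apply, RCLike.star_def]
  ring

theorem hasDerivAt_affine (a b : ℂ) (x : ℝ) : HasDerivAt (fun x : ℝ => a + b * x) b x := by
  simpa using ((Complex.ofRealCLM.hasDerivAt (x := x)).const_mul b).const_add a

theorem memH2_affine (hL : 0 < L) (a b : ℂ) : MemH2 L fun x => a + b * x :=
  MemH2.of_contDiff hL (hasDerivAt_affine a b) (fun x => hasDerivAt_const x b) continuous_const

theorem secondDeriv_affine_ae_eq (hL : 0 < L) (a b : ℂ) :
    secondDeriv L (fun x => a + b * x) =ᵐ[volume.restrict (Icc 0 L)] 0 :=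
  secondDeriv_ae_eq hL (fun x _ => (hasDerivAt_affine a b x).hasDerivWithinAt)
    (Filter.Eventually.of_forall fun x => hasDerivAt_const x b)

/-- The function `x ↦ a + b x` as an element of `L²(0, L)`. -/
def affineLp (hL : 0 < L) (a b : ℂ) : Lp ℂ 2 (volume.restrict (Icc 0 L)) :=
  (memLp_of_continuousOn ((memH2_affine hL a b).continuousOn hL)).toLp _

theorem isH2Rep_affineLp (hL : 0 < L) (a b : ℂ) :
    IsH2Rep L (fun x => a + b * x) (affineLp hL a b) 0 := by
  refine ⟨memH2_affine hL a b, MemLp.coeFn_toLp _, (Lp.coeFn_zero _ _ _).trans ?_⟩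
  filter_upwards [secondDeriv_affine_ae_eq hL a b] with x hx
  simp [hx]

theorem IsH2Rep.add (hL : 0 < L) (hf : IsH2Rep L f u v) (hg : IsH2Rep L g φ ψ) :
    IsH2Rep L (f + g) (u + φ) (v + ψ) := by
  refine ⟨hf.memH2.add hL hg.memH2, (Lp.coeFn_add _ _).trans (hf.fst_ae_eq.add hg.fst_ae_eq),
    (Lp.coeFn_add _ _).trans ((hf.snd_ae_eq.add hg.snd_ae_eq).trans ?_)⟩
  filter_upwards [secondDeriv_add hL hf.memH2 hg.memH2] with x hx
  rw [Pi.neg_apply, hx, Pi.add_apply, Pi.add_apply, Pi.neg_apply, Pi.neg_apply, neg_add]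

theorem IsH2Rep.smul (hL : 0 < L) (c : ℂ) (hf : IsH2Rep L f u v) :
    IsH2Rep L (c • f) (c • u) (c • v) := by
  refine ⟨hf.memH2.smul hL c, (Lp.coeFn_smul _ _).trans (hf.fst_ae_eq.const_smul c),
    (Lp.coeFn_smul _ _).trans ((hf.snd_ae_eq.const_smul c).trans ?_)⟩
  filter_upwards [secondDeriv_smul hL c hf.memH2] with x hx
  rw [Pi.neg_apply, hx, Pi.smul_apply, Pi.smul_apply, Pi.neg_apply, smul_neg]

-- The double antiderivative of `q` has vanishing Cauchy data at `0`, and Green's formula for it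
-- against `1` and `x` turns the two orthogonality relations into vanishing Cauchy data at `L`.
theorem exists_isH2Rep_zeroCauchyData (hL : 0 < L) {q : Lp ℂ 2 (volume.restrict (Icc 0 L))}
    (h₀ : ⟪affineLp hL 1 0, q⟫_ℂ = 0) (h₁ : ⟪affineLp hL 0 1, q⟫_ℂ = 0) :
    ∃ f φ, IsH2Rep L f φ (-q) ∧ ZeroCauchyData L f := by
  obtain ⟨f, hf, hf₀, hf₀', hf₂⟩ := exists_memH2_secondDeriv_ae_eq hL (Lp.memLp q)
  obtain ⟨φ, ψ, hrep⟩ := hf.exists_isH2Rep hL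
  obtain rfl : ψ = -q :=
    Lp.ext (hrep.snd_ae_eq.trans (hf₂.neg.trans (Lp.coeFn_neg q).symm))
  have green (a b : ℂ) := hrep.inner_sub_inner hL (isH2Rep_affineLp hL a b)
  simp only [inner_zero_left, inner_neg_right, sub_neg_eq_add, zero_add, lagrangeBracket, hf₀,
    hf₀', inner_zero_right, sub_zero,
    derivWithin_eqOn hL (fun x _ => (hasDerivAt_affine _ _ x).hasDerivWithinAt)
      (right_mem_Icc.2 hL.le)] at green
  have hfL' : derivWithin f (Icc 0 L) L = 0 := by simpa [h₀] using (green 1 0).symm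
  have hfL : f L = 0 := by simpa [h₁, hfL'] using (green 0 1).symm
  exact ⟨f, φ, hrep, hf₀, hf₀', hfL, hfL'⟩

/-- The adjoint of the minimal operator on an edge is contained in the maximal one. -/
theorem exists_isH2Rep_of_forall_inner_eq (hL : 0 < L)
    (h : ∀ f φ ψ, IsH2Rep L f φ ψ → ZeroCauchyData L f → ⟪v, φ⟫_ℂ = ⟪u, ψ⟫_ℂ) :
    ∃ g, IsH2Rep L g u v := by
  obtain ⟨W, hW, -, -, hW₂⟩ := exists_memH2_secondDeriv_ae_eq hL (Lp.memLp v)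
  obtain ⟨ω, v', hWrep⟩ := hW.exists_isH2Rep hL
  obtain rfl : v' = -v :=
    Lp.ext (hWrep.snd_ae_eq.trans (hW₂.neg.trans (Lp.coeFn_neg v).symm))
  set K : Submodule ℂ (Lp ℂ 2 (volume.restrict (Icc 0 L))) :=
    Submodule.span ℂ {affineLp hL 1 0, affineLp hL 0 1}
  have hK : FiniteDimensional ℂ K := FiniteDimensional.span_of_finite ℂ (by simp)
  have hmem : u + ω ∈ Kᗮᗮ := by
    refine (Submodule.mem_orthogonal' _ _).2 fun q hq => ?_
    have hq' (a b : ℂ) (hab : affineLp hL a b ∈ K) : ⟪affineLp hL a b, q⟫_ℂ = 0 :=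
      (Submodule.mem_orthogonal _ _).1 hq _ hab
    obtain ⟨f, φ, hf, hf₀⟩ := exists_isH2Rep_zeroCauchyData hL
      (hq' 1 0 (Submodule.subset_span (by simp))) (hq' 0 1 (Submodule.subset_span (by simp)))
    have green := hf.inner_sub_inner hL hWrep
    simp only [lagrangeBracket, hf₀.left, hf₀.right, hf₀.deriv_left, hf₀.deriv_right,
      inner_zero_right, inner_neg_left, inner_neg_right, h f φ _ hf hf₀] at green
    rw [inner_add_left]
    linear_combination green
  rw [Submodule.orthogonal_orthogonal, Submodule.mem_span_pair] at hmem
  obtain ⟨a, b, hab⟩ := hmem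
  have hrep := (((isH2Rep_affineLp hL 1 0).smul hL a).add hL
    ((isH2Rep_affineLp hL 0 1).smul hL b)).add hL (hWrep.smul hL (-1))
  rw [hab] at hrep
  exact ⟨_, by simpa using hrep⟩

end Interval

section

variable {L : ℝ} {f : ℝ → ℂ} {u v : Lp ℂ 2 (volume.restrict (Icc 0 L))}

theorem IsH2Rep.eq_zero (h : IsH2Rep L 0 u v) : u = 0 ∧ v = 0 := by
  refine ⟨Lp.ext (h.fst_ae_eq.trans (Lp.coeFn_zero _ _ _).symm),
    Lp.ext (h.snd_ae_eq.trans ?_)⟩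
  rw [secondDeriv_zero, neg_zero]
  exact (Lp.coeFn_zero _ _ _).symm

theorem IsH2Rep.fst_ae_eq_zero (h : IsH2Rep L f 0 v) : f =ᵐ[volume.restrict (Icc 0 L)] 0 :=
  h.fst_ae_eq.symm.trans (Lp.coeFn_zero _ _ _)

theorem IsH2Rep.eqOn_zero (hL : 0 < L) (h : IsH2Rep L f 0 v) : EqOn f 0 (Icc 0 L) :=
  Measure.eqOn_Icc_of_ae_eq volume hL.ne h.fst_ae_eq_zero (h.memH2.continuousOn hL)
    continuousOn_const

theorem IsH2Rep.zero_rep (hL : 0 < L) (h : IsH2Rep L f 0 v) : IsH2Rep L 0 0 v := by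
  refine ⟨MemH2.zero L, Lp.coeFn_zero _ _ _, h.snd_ae_eq.trans ?_⟩
  filter_upwards [ae_restrict_mem measurableSet_Icc] with x hx
  simp [secondDeriv_eq_zero hL h.memH2 h.fst_ae_eq_zero hx, secondDeriv_zero]

end

/-! ### Adjoints of closures -/

section Adjoint

variable {H : Type*} [NormedAddCommGroup H] [InnerProductSpace ℂ H] [CompleteSpace H]
  {T : H →ₗ.[ℂ] H}

theorem mem_graph_adjoint_iff (hT : Dense (T.domain : Set H)) {x : H × H} :
    x ∈ T.adjoint.graph ↔ ∀ p ∈ T.graph, ⟪x.2, p.1⟫_ℂ = ⟪x.1, p.2⟫_ℂ := by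
  have hconj (p : H × H) :
      ⟪p.2, x.1⟫_ℂ - ⟪p.1, x.2⟫_ℂ = 0 ↔ ⟪x.2, p.1⟫_ℂ = ⟪x.1, p.2⟫_ℂ := by
    rw [sub_eq_zero, ← (starRingEnd ℂ).injective.eq_iff, inner_conj_symm, inner_conj_symm, eq_comm]
  rw [LinearPMap.adjoint_graph_eq_graph_adjoint hT, Submodule.mem_adjoint_iff]
  exact ⟨fun h p hp => (hconj p).1 (h p.1 p.2 hp), fun h a b hab => (hconj (a, b)).2 (h _ hab)⟩

theorem adjoint_closure (hT : Dense (T.domain : Set H)) : T.closure.adjoint = T.adjoint := by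
  refine LinearPMap.eq_of_eq_graph (Submodule.ext fun x => ?_)
  rw [mem_graph_adjoint_iff hT, mem_graph_adjoint_iff (hT.mono T.le_closure.1)]
  refine ⟨fun h p hp => h p (LinearPMap.le_graph_of_le T.le_closure hp), fun h => ?_⟩
  by_cases hc : T.IsClosable
  · rw [← hc.graph_closure_eq_closure_graph]
    have hcl : IsClosed {p : H × H | ⟪x.2, p.1⟫_ℂ = ⟪x.1, p.2⟫_ℂ} :=
      isClosed_eq (by fun_prop) (by fun_prop)
    exact fun p hp => closure_minimal (s := (T.graph : Set (H × H))) h hcl hp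
  · rwa [LinearPMap.closure_def' hc]

end Adjoint

/-! ### Green's formula on a metric graph -/

section Green

variable {V : Type*} {G : SimpleGraph V} {ℓ : G.edgeSet → ℝ} {o : Orientation G}
  {f g : G.edgeSet → ℝ → ℂ} {u w φ ψ : L2 G ℓ} {e : G.edgeSet} {v : V}

theorem Orientation.mem_iff (o : Orientation G) : v ∈ e.1 ↔ v = o.tail e ∨ v = o.head e := by
  rw [← o.mk_eq e, Sym2.mem_iff]

theorem Orientation.tail_mem (o : Orientation G) (e : G.edgeSet) : o.tail e ∈ e.1 :=
  o.mem_iff.2 (Or.inl rfl)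

theorem Orientation.head_mem (o : Orientation G) (e : G.edgeSet) : o.head e ∈ e.1 :=
  o.mem_iff.2 (Or.inr rfl)

theorem Orientation.adj (o : Orientation G) (e : G.edgeSet) : G.Adj (o.tail e) (o.head e) := by
  rw [← SimpleGraph.mem_edgeSet, o.mk_eq]
  exact e.2

theorem Orientation.head_ne_tail (o : Orientation G) (e : G.edgeSet) : o.head e ≠ o.tail e :=
  (o.adj e).ne'

theorem starEdge_injective (v : V) : Function.Injective (starEdge (G := G) v) := by
  intro w w' h
  have := congrArg Subtype.val h
  simp only [starEdge, Sym2.congr_right] at this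
  exact Subtype.ext this

theorem mem_starEdge (v : V) (w : G.neighborSet v) : v ∈ (starEdge v w).1 :=
  Sym2.mem_mk_left _ _

theorem exists_starEdge_eq (h : v ∈ e.1) : ∃ w, starEdge v w = e := by
  obtain ⟨w, hw⟩ := Sym2.mem_iff_exists.1 h
  exact ⟨⟨w, by simpa [hw] using e.2⟩, Subtype.ext hw.symm⟩

theorem vertexValue_tail : vertexValue o ℓ f e (o.tail e) = f e 0 := if_pos rfl

theorem vertexValue_head : vertexValue o ℓ f e (o.head e) = f e (ℓ e) :=
  if_neg (o.head_ne_tail e)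

theorem vertexDeriv_tail :
    vertexDeriv o ℓ f e (o.tail e) = derivWithin (f e) (Icc 0 (ℓ e)) 0 := if_pos rfl

theorem vertexDeriv_head :
    vertexDeriv o ℓ f e (o.head e) = -derivWithin (f e) (Icc 0 (ℓ e)) (ℓ e) :=
  if_neg (o.head_ne_tail e)

/-- The contribution of the endpoint `v` of the edge `e` to the boundary term in Green's
formula. -/
def boundaryForm (o : Orientation G) (ℓ : G.edgeSet → ℝ) (g f : G.edgeSet → ℝ → ℂ)
    (e : G.edgeSet) (v : V) : ℂ :=
  ⟪vertexDeriv o ℓ g e v, vertexValue o ℓ f e v⟫_ℂ -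
    ⟪vertexValue o ℓ g e v, vertexDeriv o ℓ f e v⟫_ℂ

theorem lagrangeBracket_sub_eq_boundaryForm :
    lagrangeBracket (ℓ e) (g e) (f e) (ℓ e) - lagrangeBracket (ℓ e) (g e) (f e) 0 =
      boundaryForm o ℓ g f e (o.tail e) + boundaryForm o ℓ g f e (o.head e) := by
  simp only [lagrangeBracket, boundaryForm, vertexValue_tail, vertexValue_head, vertexDeriv_tail,
    vertexDeriv_head, inner_neg_left, inner_neg_right]
  ring

theorem inner_sub_inner_eq_sum_boundaryForm (hℓ : ∀ e, 0 < ℓ e)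
    (hg : ∀ e, IsH2Rep (ℓ e) (g e) (u e) (w e)) (hf : ∀ e, IsH2Rep (ℓ e) (f e) (φ e) (ψ e))
    {E : Finset G.edgeSet} (hE : ∀ e ∉ E, f e = 0) :
    ⟪w, φ⟫_ℂ - ⟪u, ψ⟫_ℂ =
      ∑ e ∈ E, (boundaryForm o ℓ g f e (o.tail e) + boundaryForm o ℓ g f e (o.head e)) := by
  have hzero (e) (he : e ∉ E) : φ e = 0 ∧ ψ e = 0 := IsH2Rep.eq_zero (hE e he ▸ hf e)
  rw [lp.inner_eq_tsum, lp.inner_eq_tsum,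
    tsum_eq_sum fun e he => by rw [(hzero e he).1, inner_zero_right],
    tsum_eq_sum fun e he => by rw [(hzero e he).2, inner_zero_right], ← Finset.sum_sub_distrib]
  exact Finset.sum_congr rfl fun e _ =>
    ((hf e).inner_sub_inner (hℓ e) (hg e)).trans lagrangeBracket_sub_eq_boundaryForm

theorem sum_filter_mem_eq_sum_neighborSet [G.LocallyFinite] [DecidableEq V] (h : G.edgeSet → ℂ)
    {E : Finset G.edgeSet} (hE : ∀ e ∉ E, h e = 0) (v : V) :
    ∑ e ∈ E with v ∈ e.1, h e = ∑ w : G.neighborSet v, h (starEdge v w) := by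
  rw [← Finset.sum_image (s := Finset.univ) (g := starEdge v) (f := h)
    (fun w _ w' _ hw => starEdge_injective v hw)]
  refine Finset.sum_subset (fun e he => ?_) fun e he he' => hE _ fun h' => he' ?_
  · obtain ⟨w, hw⟩ := exists_starEdge_eq (Finset.mem_filter.1 he).2
    exact Finset.mem_image.2 ⟨w, Finset.mem_univ _, hw⟩
  · obtain ⟨w, -, rfl⟩ := Finset.mem_image.1 he
    exact Finset.mem_filter.2 ⟨h', mem_starEdge v w⟩

theorem sum_endpoints_eq_sum_neighborSet [G.LocallyFinite] [DecidableEq V] (o : Orientation G)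
    (h : G.edgeSet → V → ℂ) {E : Finset G.edgeSet} (hE : ∀ e ∉ E, ∀ v, h e v = 0) :
    ∑ e ∈ E, (h e (o.tail e) + h e (o.head e)) =
      ∑ v ∈ E.image o.tail ∪ E.image o.head, ∑ w : G.neighborSet v, h (starEdge v w) v := by
  have hends (e) (he : e ∈ E) : h e (o.tail e) + h e (o.head e) =
      ∑ v ∈ E.image o.tail ∪ E.image o.head, if v ∈ e.1 then h e v else 0 := by
    rw [← Finset.sum_filter, ← Finset.sum_pair (o.head_ne_tail e).symm]
    refine Finset.sum_congr (Finset.ext fun v => ?_) fun _ _ => rfl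
    simp only [Finset.mem_insert, Finset.mem_singleton, Finset.mem_filter, Finset.mem_union,
      Finset.mem_image, o.mem_iff]
    refine ⟨fun hv => ⟨?_, hv⟩, And.right⟩
    exact hv.imp (fun hv => ⟨e, he, hv.symm⟩) fun hv => ⟨e, he, hv.symm⟩
  rw [Finset.sum_congr rfl hends, Finset.sum_comm]
  refine Finset.sum_congr rfl fun v _ => ?_
  rw [← Finset.sum_filter]
  exact sum_filter_mem_eq_sum_neighborSet _ (fun e he => hE e he v) v

theorem sum_boundaryForm_eq_zero [G.LocallyFinite] (hg : Kirchhoff o ℓ g v)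
    (hf : Kirchhoff o ℓ f v) :
    ∑ w : G.neighborSet v, boundaryForm o ℓ g f (starEdge v w) v = 0 := by
  rcases isEmpty_or_nonempty (G.neighborSet v) with h | ⟨⟨w₀⟩⟩
  · exact Finset.sum_of_isEmpty _
  calc ∑ w : G.neighborSet v, boundaryForm o ℓ g f (starEdge v w) v
      = ∑ w : G.neighborSet v,
        (⟪vertexDeriv o ℓ g (starEdge v w) v, vertexValue o ℓ f (starEdge v w₀) v⟫_ℂ -
          ⟪vertexValue o ℓ g (starEdge v w₀) v, vertexDeriv o ℓ f (starEdge v w) v⟫_ℂ) :=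
        Finset.sum_congr rfl fun w _ => by rw [boundaryForm, hf.1 w w₀, hg.1 w w₀]
    _ = 0 := by
      rw [Finset.sum_sub_distrib, ← sum_inner, ← inner_sum, hf.2, hg.2, inner_zero_left,
        inner_zero_right, sub_zero]

/-! ### Test functions -/

theorem mem_laplacianGraph_iff [G.LocallyFinite] (hℓ : ∀ e, 0 < ℓ e) {p : L2 G ℓ × L2 G ℓ} :
    p ∈ laplacianGraph o hℓ ↔
      ∃ f, (∀ e, IsH2Rep (ℓ e) (f e) (p.1 e) (p.2 e)) ∧ ∀ v, Kirchhoff o ℓ f v :=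
  ⟨fun ⟨f, hf, kf, h₁, h₂⟩ => ⟨f, fun e => ⟨hf e, h₁ e, h₂ e⟩, kf⟩, fun ⟨f, hf, kf⟩ =>
    ⟨f, fun e => (hf e).memH2, kf, fun e => (hf e).fst_ae_eq, fun e => (hf e).snd_ae_eq⟩⟩

theorem mem_graph_preminimalLaplacian_iff [G.LocallyFinite] (hℓ : ∀ e, 0 < ℓ e)
    {p : L2 G ℓ × L2 G ℓ} :
    p ∈ (preminimalLaplacian o hℓ).graph ↔ p ∈ laplacianGraph o hℓ ∧ p.1 ∈ L2c G ℓ := by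
  rw [← maximalLaplacian_graph, LinearPMap.mem_graph_iff', LinearPMap.mem_graph_iff']
  constructor
  · rintro ⟨⟨y, hy⟩, rfl⟩
    exact ⟨⟨⟨y, hy.2⟩, rfl⟩, hy.1⟩
  · rintro ⟨⟨y, rfl⟩, h⟩
    exact ⟨⟨y, h, y.2⟩, rfl⟩

theorem Kirchhoff.congr [G.LocallyFinite] (hℓ : ∀ e, 0 < ℓ e)
    (h : ∀ e, EqOn (f e) (g e) (Icc 0 (ℓ e))) (hf : Kirchhoff o ℓ f v) : Kirchhoff o ℓ g v := by
  have h₀ (e) : 0 ∈ Icc 0 (ℓ e) := left_mem_Icc.2 (hℓ e).le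
  have h₁ (e) : ℓ e ∈ Icc 0 (ℓ e) := right_mem_Icc.2 (hℓ e).le
  simpa only [Kirchhoff, vertexValue, vertexDeriv, h _ (h₀ _), h _ (h₁ _),
    derivWithin_congr_Icc (h _) (h₀ _), derivWithin_congr_Icc (h _) (h₁ _)] using hf

theorem exists_mem_graph_preminimalLaplacian [G.LocallyFinite] (hℓ : ∀ e, 0 < ℓ e)
    (hf : ∀ e, MemH2 (ℓ e) (f e)) (kf : ∀ v, Kirchhoff o ℓ f v) {E : Finset G.edgeSet}
    (hE : ∀ e ∉ E, f e = 0) :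
    ∃ p ∈ (preminimalLaplacian o hℓ).graph, ∀ e, IsH2Rep (ℓ e) (f e) (p.1 e) (p.2 e) := by
  choose φ ψ hrep using fun e => (hf e).exists_isH2Rep (hℓ e)
  have hzero (e) (he : e ∉ E) : φ e = 0 ∧ ψ e = 0 := IsH2Rep.eq_zero (hE e he ▸ hrep e)
  have hφ : {e | φ e ≠ 0}.Finite :=
    E.finite_toSet.subset fun e he => by_contra fun h => he (hzero e h).1
  have hψ : {e | ψ e ≠ 0}.Finite :=
    E.finite_toSet.subset fun e he => by_contra fun h => he (hzero e h).2
  exact ⟨(⟨φ, (memℓp_zero hφ).of_exponent_ge zero_le⟩, ⟨ψ, (memℓp_zero hψ).of_exponent_ge zero_le⟩),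
    (mem_graph_preminimalLaplacian_iff hℓ).2 ⟨(mem_laplacianGraph_iff hℓ).2 ⟨f, hrep, kf⟩, hφ⟩,
    hrep⟩

theorem exists_isH2Rep_of_mem_graph_preminimalLaplacian [G.LocallyFinite] (hℓ : ∀ e, 0 < ℓ e)
    {p : L2 G ℓ × L2 G ℓ} (hp : p ∈ (preminimalLaplacian o hℓ).graph) :
    ∃ (f : G.edgeSet → ℝ → ℂ) (E : Finset G.edgeSet),
      (∀ e, IsH2Rep (ℓ e) (f e) (p.1 e) (p.2 e)) ∧ (∀ v, Kirchhoff o ℓ f v) ∧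
        ∀ e ∉ E, f e = 0 := by
  classical
  obtain ⟨hp, hfin⟩ := (mem_graph_preminimalLaplacian_iff hℓ).1 hp
  obtain ⟨f, hf, kf⟩ := (mem_laplacianGraph_iff hℓ).1 hp
  have hfin : {e | p.1 e ≠ 0}.Finite := hfin
  have hoff (e) (he : e ∉ hfin.toFinset) : p.1 e = 0 := by simpa using he
  have hoff' (e) (he : e ∉ hfin.toFinset) : IsH2Rep (ℓ e) (f e) 0 (p.2 e) := hoff e he ▸ hf e
  refine ⟨fun e => if e ∈ hfin.toFinset then f e else 0, hfin.toFinset, fun e => ?_,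
    fun v => (kf v).congr hℓ fun e => ?_, fun e he => if_neg he⟩ <;> beta_reduce <;>
    split_ifs with he
  · exact hf e
  · exact hoff e he ▸ (hoff' e he).zero_rep (hℓ e)
  · exact eqOn_refl _ _
  · exact (hoff' e he).eqOn_zero (hℓ e)

end Green

section

variable {L : ℝ} {f : ℝ → ℂ}

theorem isH2Rep_zero (L : ℝ) : IsH2Rep L 0 0 0 := by
  refine ⟨MemH2.zero L, Lp.coeFn_zero _ _ _, ?_⟩
  rw [secondDeriv_zero, neg_zero]
  exact Lp.coeFn_zero _ _ _

theorem zeroCauchyData_zero (L : ℝ) : ZeroCauchyData L 0 :=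
  ⟨rfl, by simp, rfl, by simp⟩

/-- The cubic polynomial on `[0, L]` with value `a` and derivative `a'` at `0`, and value `b` and
derivative `b'` at `L` (Hermite interpolation). -/
def hermiteCubic (L : ℝ) (a a' b b' : ℂ) (x : ℝ) : ℂ :=
  a + a' * x + (3 * (b - a) / L ^ 2 - (2 * a' + b') / L) * x ^ 2 +
    (2 * (a - b) / L ^ 3 + (a' + b') / L ^ 2) * x ^ 3

theorem hermiteCubic_zero : hermiteCubic L 0 0 0 0 = 0 := by
  ext x
  simp [hermiteCubic]

theorem hermiteCubic_left (a a' b b' : ℂ) : hermiteCubic L a a' b b' 0 = a := by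
  simp [hermiteCubic]

theorem hermiteCubic_right (hL : 0 < L) (a a' b b' : ℂ) : hermiteCubic L a a' b b' L = b := by
  have : (L : ℂ) ≠ 0 := mod_cast hL.ne'
  rw [hermiteCubic]
  field_simp
  ring

theorem hasDerivAt_cubic (a b c d : ℂ) (x : ℝ) :
    HasDerivAt (fun x : ℝ => a + b * x + c * x ^ 2 + d * x ^ 3)
      (b + 2 * c * x + 3 * d * x ^ 2) x := by
  have h := Complex.ofRealCLM.hasDerivAt (x := x)
  refine ((((h.const_mul b).const_add a).add ((h.pow 2).const_mul c)).add
    ((h.pow 3).const_mul d)).congr_deriv ?_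
  simp only [Complex.ofRealCLM_apply, Complex.ofReal_one]
  push_cast
  ring

theorem memH2_hermiteCubic (hL : 0 < L) (a a' b b' : ℂ) : MemH2 L (hermiteCubic L a a' b b') := by
  refine MemH2.of_contDiff hL (hasDerivAt_cubic _ _ _ _) (fun x => ?_) (f₂ := fun x =>
    2 * (3 * (b - a) / L ^ 2 - (2 * a' + b') / L) +
      2 * (3 * (2 * (a - b) / L ^ 3 + (a' + b') / L ^ 2)) * x) (by fun_prop)
  simpa using hasDerivAt_cubic a' (2 * (3 * (b - a) / L ^ 2 - (2 * a' + b') / L))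
    (3 * (2 * (a - b) / L ^ 3 + (a' + b') / L ^ 2)) 0 x

theorem derivWithin_hermiteCubic_left (hL : 0 < L) (a a' b b' : ℂ) :
    derivWithin (hermiteCubic L a a' b b') (Icc 0 L) 0 = a' := by
  rw [derivWithin_eqOn hL (f := hermiteCubic L a a' b b')
    (fun x _ => (hasDerivAt_cubic _ _ _ _ x).hasDerivWithinAt) (left_mem_Icc.2 hL.le)]
  simp

theorem derivWithin_hermiteCubic_right (hL : 0 < L) (a a' b b' : ℂ) :
    derivWithin (hermiteCubic L a a' b b') (Icc 0 L) L = b' := by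
  have : (L : ℂ) ≠ 0 := mod_cast hL.ne'
  rw [derivWithin_eqOn hL (f := hermiteCubic L a a' b b')
    (fun x _ => (hasDerivAt_cubic _ _ _ _ x).hasDerivWithinAt) (right_mem_Icc.2 hL.le)]
  field_simp
  ring

end

section Adjoint

variable {V : Type*} {G : SimpleGraph V} {ℓ : G.edgeSet → ℝ} {o : Orientation G}
  {f g : G.edgeSet → ℝ → ℂ} {u w : L2 G ℓ} {e : G.edgeSet} {v : V}

theorem exists_memH2_vertexData (o : Orientation G) (hℓ : ∀ e, 0 < ℓ e) (a b : G.edgeSet → V → ℂ) :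
    ∃ f : G.edgeSet → ℝ → ℂ, (∀ e, MemH2 (ℓ e) (f e)) ∧
      (∀ e, ∀ v ∈ e.1, vertexValue o ℓ f e v = a e v ∧ vertexDeriv o ℓ f e v = b e v) ∧
      ∀ e, (∀ v ∈ e.1, a e v = 0 ∧ b e v = 0) → f e = 0 := by
  refine ⟨fun e => hermiteCubic (ℓ e) (a e (o.tail e)) (b e (o.tail e)) (a e (o.head e))
    (-b e (o.head e)), fun e => memH2_hermiteCubic (hℓ e) _ _ _ _, fun e v hv => ?_,
    fun e he => ?_⟩
  · obtain rfl | rfl := o.mem_iff.1 hv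
    · exact ⟨vertexValue_tail.trans (hermiteCubic_left _ _ _ _),
        vertexDeriv_tail.trans (derivWithin_hermiteCubic_left (hℓ e) _ _ _ _)⟩
    · refine ⟨vertexValue_head.trans (hermiteCubic_right (hℓ e) _ _ _ _), ?_⟩
      rw [vertexDeriv_head, derivWithin_hermiteCubic_right (hℓ e), neg_neg]
  · simp only [he _ (o.tail_mem e), he _ (o.head_mem e), neg_zero]
    exact hermiteCubic_zero

theorem kirchhoff_of_zeroCauchyData [G.LocallyFinite] (h : ∀ e, ZeroCauchyData (ℓ e) (f e)) :
    Kirchhoff o ℓ f v := by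
  simp [Kirchhoff, vertexValue, vertexDeriv, (h _).left, (h _).right, (h _).deriv_left,
    (h _).deriv_right]

theorem add_tail_head_eq (o : Orientation G) {h : V → ℂ} (hv : v ∈ e.1)
    (h0 : ∀ v' ∈ e.1, v' ≠ v → h v' = 0) : h (o.tail e) + h (o.head e) = h v := by
  obtain rfl | rfl := o.mem_iff.1 hv
  · rw [h0 _ (o.head_mem e) (o.head_ne_tail e), add_zero]
  · rw [h0 _ (o.tail_mem e) (o.head_ne_tail e).symm, zero_add]

variable [G.LocallyFinite]

theorem exists_isH2Rep_of_adjoint (hℓ : ∀ e, 0 < ℓ e)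
    (h : ∀ p ∈ (preminimalLaplacian o hℓ).graph, ⟪w, p.1⟫_ℂ = ⟪u, p.2⟫_ℂ) (e : G.edgeSet) :
    ∃ g, IsH2Rep (ℓ e) g (u e) (w e) := by
  classical
  refine exists_isH2Rep_of_forall_inner_eq (hℓ e) fun f φ ψ hf hf₀ => ?_
  set p : L2 G ℓ × L2 G ℓ := (lp.single 2 e φ, lp.single 2 e ψ)
  have hne {e'} (he : e' ≠ e) : p.1 e' = 0 ∧ p.2 e' = 0 := by
    simp [p, he]
  have hrep (e') : IsH2Rep (ℓ e') ((Pi.single e f : G.edgeSet → ℝ → ℂ) e') (p.1 e') (p.2 e') ∧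
      ZeroCauchyData (ℓ e') ((Pi.single e f : G.edgeSet → ℝ → ℂ) e') := by
    obtain rfl | he := eq_or_ne e' e
    · simpa [p] using ⟨hf, hf₀⟩
    · rw [Pi.single_eq_of_ne he, (hne he).1, (hne he).2]
      exact ⟨isH2Rep_zero _, zeroCauchyData_zero _⟩
  have hp : p ∈ (preminimalLaplacian o hℓ).graph := by
    refine (mem_graph_preminimalLaplacian_iff hℓ).2 ⟨(mem_laplacianGraph_iff hℓ).2
      ⟨_, fun e' => (hrep e').1, fun v => kirchhoff_of_zeroCauchyData fun e' => (hrep e').2⟩, ?_⟩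
    exact (Set.finite_singleton e).subset fun e' he => by_contra fun hn => he (hne hn).1
  simpa only [p, lp.inner_single_right] using h p hp

theorem sum_boundaryForm_eq_zero_of_adjoint (hℓ : ∀ e, 0 < ℓ e)
    (h : ∀ p ∈ (preminimalLaplacian o hℓ).graph, ⟪w, p.1⟫_ℂ = ⟪u, p.2⟫_ℂ)
    (hg : ∀ e, IsH2Rep (ℓ e) (g e) (u e) (w e)) (v : V) (s : ℂ) {t : G.edgeSet → ℂ}
    (ht : ∑ x : G.neighborSet v, t (starEdge v x) = 0) :
    ∑ x : G.neighborSet v, (⟪vertexDeriv o ℓ g (starEdge v x) v, s⟫_ℂ -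
      ⟪vertexValue o ℓ g (starEdge v x) v, t (starEdge v x)⟫_ℂ) = 0 := by
  classical
  obtain ⟨f, hf, hdata, hzero⟩ := exists_memH2_vertexData o hℓ
    (fun _ => Pi.single v s) (fun e => Pi.single v (t e))
  have kf (v') : Kirchhoff o ℓ f v' := by
    refine ⟨fun x x' => ?_, ?_⟩
    · rw [(hdata _ _ (mem_starEdge v' x)).1, (hdata _ _ (mem_starEdge v' x')).1]
    · simp only [(hdata _ _ (mem_starEdge v' _)).2]
      obtain rfl | hv := eq_or_ne v' v
      · simpa using ht
      · simp [hv]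
  have hE (e) (he : e ∉ Finset.univ.image (starEdge (G := G) v)) : f e = 0 := by
    refine hzero e fun v' hv' => ?_
    have : v' ≠ v := by
      rintro rfl
      obtain ⟨x, rfl⟩ := exists_starEdge_eq hv'
      exact he (Finset.mem_image_of_mem _ (Finset.mem_univ x))
    simp [this]
  obtain ⟨p, hp, hrep⟩ := exists_mem_graph_preminimalLaplacian hℓ hf kf hE
  have green := inner_sub_inner_eq_sum_boundaryForm (o := o) hℓ hg hrep hE
  rw [h p hp, sub_self, Finset.sum_image fun x _ x' _ hx => starEdge_injective v hx] at green
  refine (Finset.sum_congr rfl fun x _ => ?_).trans green.symm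
  have hform (v') (hv' : v' ∈ (starEdge v x).1) :
      boundaryForm o ℓ g f (starEdge v x) v' =
        ⟪vertexDeriv o ℓ g (starEdge v x) v', (Pi.single v s : V → ℂ) v'⟫_ℂ -
          ⟪vertexValue o ℓ g (starEdge v x) v', (Pi.single v (t (starEdge v x)) : V → ℂ) v'⟫_ℂ := by
    rw [boundaryForm, (hdata _ _ hv').1, (hdata _ _ hv').2]
  rw [add_tail_head_eq o (mem_starEdge v x) fun v' hv' hne => by simp [hform v' hv', hne],
    hform v (mem_starEdge v x), Pi.single_eq_same, Pi.single_eq_same]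

theorem kirchhoff_of_adjoint (hℓ : ∀ e, 0 < ℓ e)
    (h : ∀ p ∈ (preminimalLaplacian o hℓ).graph, ⟪w, p.1⟫_ℂ = ⟪u, p.2⟫_ℂ)
    (hg : ∀ e, IsH2Rep (ℓ e) (g e) (u e) (w e)) (v : V) : Kirchhoff o ℓ g v := by
  classical
  refine ⟨fun x x' => ?_, ?_⟩
  · have := sum_boundaryForm_eq_zero_of_adjoint hℓ h hg v 0
      (t := Pi.single (starEdge v x) 1 - Pi.single (starEdge v x') 1)
      (by simp [Pi.single_apply, (starEdge_injective v).eq_iff])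
    simp only [zero_sub, Finset.sum_neg_distrib, neg_eq_zero, Pi.sub_apply,
      Pi.single_apply, (starEdge_injective v).eq_iff, RCLike.inner_apply, sub_mul, ite_mul, one_mul,
      zero_mul, Finset.sum_sub_distrib, Finset.sum_ite_eq', Finset.mem_univ, if_true,
      sub_eq_zero] at this
    exact (starRingEnd ℂ).injective this
  · have := sum_boundaryForm_eq_zero_of_adjoint hℓ h hg v 1 (t := 0) (by simp)
    simpa [← map_sum] using this

theorem forall_inner_eq_iff_mem_laplacianGraph (hℓ : ∀ e, 0 < ℓ e) :
    (∀ p ∈ (preminimalLaplacian o hℓ).graph, ⟪w, p.1⟫_ℂ = ⟪u, p.2⟫_ℂ) ↔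
      (u, w) ∈ laplacianGraph o hℓ := by
  classical
  refine ⟨fun h => ?_, fun h p hp => ?_⟩
  · choose g hg using exists_isH2Rep_of_adjoint hℓ h
    exact (mem_laplacianGraph_iff hℓ).2 ⟨g, hg, kirchhoff_of_adjoint hℓ h hg⟩
  · obtain ⟨g, hg, kg⟩ := (mem_laplacianGraph_iff hℓ).1 h
    obtain ⟨f, E, hf, kf, hE⟩ := exists_isH2Rep_of_mem_graph_preminimalLaplacian hℓ hp
    have hform (e) (he : e ∉ E) (v) : boundaryForm o ℓ g f e v = 0 := by
      simp [boundaryForm, vertexValue, vertexDeriv, hE e he]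
    rw [← sub_eq_zero, inner_sub_inner_eq_sum_boundaryForm (o := o) hℓ hg hf hE,
      sum_endpoints_eq_sum_neighborSet o _ hform]
    exact Finset.sum_eq_zero fun v _ => sum_boundaryForm_eq_zero (kg v) (kf v)

theorem dense_domain_preminimalLaplacian (o : Orientation G) (hℓ : ∀ e, 0 < ℓ e) :
    Dense ((preminimalLaplacian o hℓ).domain : Set (L2 G ℓ)) := by
  rw [Submodule.dense_iff_topologicalClosure_eq_top, Submodule.topologicalClosure_eq_top_iff,
    Submodule.eq_bot_iff]
  intro w hw
  have hmem : (0, w) ∈ laplacianGraph o hℓ :=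
    (forall_inner_eq_iff_mem_laplacianGraph hℓ).1 fun p hp => by
      rw [inner_zero_left,
        (Submodule.mem_orthogonal' _ _).1 hw p.1 (LinearPMap.mem_domain_of_mem_graph hp)]
  rw [← maximalLaplacian_graph] at hmem
  exact LinearPMap.graph_fst_eq_zero_snd _ hmem rfl

theorem adjoint_minimalLaplacian (o : Orientation G) (hℓ : ∀ e, 0 < ℓ e) :
    (minimalLaplacian o hℓ).adjoint = maximalLaplacian o hℓ := by
  have hd := dense_domain_preminimalLaplacian o hℓ
  rw [minimalLaplacian, adjoint_closure hd]
  refine LinearPMap.eq_of_eq_graph (Submodule.ext fun x => ?_)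
  rw [mem_graph_adjoint_iff hd, maximalLaplacian_graph]
  exact forall_inner_eq_iff_mem_laplacianGraph hℓ

theorem mem_deficiencySubspace_minimalLaplacian_iff (hℓ : ∀ e, 0 < ℓ e) {z : ℂ} :
    u ∈ deficiencySubspace (minimalLaplacian o hℓ) z ↔ (u, z • u) ∈ laplacianGraph o hℓ := by
  rw [deficiencySubspace, adjoint_minimalLaplacian, maximalLaplacian_graph]
  rfl

end Adjoint

/-! ### The eigenvalue equation on an edge -/

section Edge

/-- The solution of `f'' = κ² f` with `f 0 = 0` and `f' 0 = 1`, for `κ ≠ 0`. -/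
def sinSol (κ : ℂ) (x : ℝ) : ℂ := Complex.sinh (κ * x) / κ

/-- The solution of `f'' = κ² f` with `f 0 = 1` and `f' 0 = 0`. -/
def cosSol (κ : ℂ) (x : ℝ) : ℂ := Complex.cosh (κ * x)

/-- The solution of `f'' = κ² f` on `[0, L]` with boundary values `f 0 = a` and `f L = b`, which
exists and is unique if `sinSol κ L ≠ 0`. -/
def dirichletSol (κ : ℂ) (L : ℝ) (a b : ℂ) (t : ℝ) : ℂ :=
  (a * sinSol κ (L - t) + b * sinSol κ t) / sinSol κ L

variable {κ : ℂ} {L : ℝ} {f : ℝ → ℂ}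

theorem sinSol_zero (κ : ℂ) : sinSol κ 0 = 0 := by simp [sinSol]

theorem cosSol_zero (κ : ℂ) : cosSol κ 0 = 1 := by simp [cosSol]

theorem sinSol_sub (hκ : κ ≠ 0) (s t : ℝ) :
    sinSol κ (s - t) = sinSol κ s * cosSol κ t - cosSol κ s * sinSol κ t := by
  simp only [sinSol, cosSol, Complex.ofReal_sub, mul_sub, Complex.sinh_sub]
  field_simp

theorem hasDerivAt_sinSol (hκ : κ ≠ 0) (x : ℝ) : HasDerivAt (sinSol κ) (cosSol κ x) x := by
  have h : HasDerivAt (fun z : ℂ => Complex.sinh (κ * z) / κ) (cosSol κ x) x := by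
    refine ((((hasDerivAt_id (x : ℂ)).const_mul κ).csinh).div_const κ).congr_deriv ?_
    simp only [cosSol, id_eq]
    field_simp
  exact h.comp_ofReal

theorem hasDerivAt_cosSol (hκ : κ ≠ 0) (x : ℝ) :
    HasDerivAt (cosSol κ) (κ ^ 2 * sinSol κ x) x := by
  have h : HasDerivAt (fun z : ℂ => Complex.cosh (κ * z)) (κ ^ 2 * sinSol κ x) x := by
    refine (((hasDerivAt_id (x : ℂ)).const_mul κ).ccosh).congr_deriv ?_
    simp only [sinSol, id_eq]
    field_simp
  exact h.comp_ofReal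

theorem continuous_sinSol (κ : ℂ) : Continuous (sinSol κ) := by
  unfold sinSol
  fun_prop

theorem continuous_cosSol (κ : ℂ) : Continuous (cosSol κ) := by
  unfold cosSol
  fun_prop

theorem MemH2.eq_cosSol_add_sinSol (hκ : κ ≠ 0) (hL : 0 < L) (hf : MemH2 L f)
    (h : secondDeriv L f =ᵐ[volume.restrict (Icc 0 L)] fun t => κ ^ 2 * f t) {t : ℝ}
    (ht : t ∈ Icc 0 L) :
    f t = f 0 * cosSol κ t + derivWithin f (Icc 0 L) 0 * sinSol κ t := by
  have hs (s : ℝ) := (hasDerivAt_sinSol hκ (t - s)).comp_const_sub t s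
  have hc (s : ℝ) := (hasDerivAt_cosSol hκ (t - s)).comp_const_sub t s
  have acs := absolutelyContinuous_of_hasDerivWithinAt hL (fun s _ => (hs s).hasDerivWithinAt)
    ((continuous_cosSol κ).comp (continuous_sub_left t)).neg.continuousOn
  have acc := absolutelyContinuous_of_hasDerivWithinAt hL (fun s _ => (hc s).hasDerivWithinAt)
    (((continuous_sinSol κ).comp (continuous_sub_left t)).const_mul _).neg.continuousOn
  -- The value at `t` of the solution with Cauchy data `(f s, f' s)` at `s` does not depend on `s`.
  obtain ⟨C, hC⟩ := ((hf.1.1.smul acc).add (hf.2.1.smul acs)).const_of_ae_hasDerivAt_zero (by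
    have hae : ∀ᵐ s ∂volume.restrict (Icc 0 L), HasDerivAt (f • (fun s => cosSol κ (t - s)) +
        derivWithin f (Icc 0 L) • fun s => sinSol κ (t - s)) 0 s := by
      filter_upwards [ae_hasDerivAt_of_absolutelyContinuous hL hf.1.1,
        ae_hasDerivAt_of_absolutelyContinuous hL hf.2.1, h] with s hf₁ hf₂ hs₂
      refine ((hf₁.mul (hc s)).add (hf₂.mul (hs s))).congr_deriv ?_
      rw [← secondDeriv, hs₂]
      ring
    rwa [uIcc_of_le hL.le, ← ae_restrict_iff' measurableSet_Icc])
  rw [uIcc_of_le hL.le] at hC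
  have h₀ := hC 0 (left_mem_Icc.2 hL.le)
  have h₁ := hC t ht
  simp only [Pi.add_apply, smul_eq_mul, Pi.mul_apply, sub_zero, sub_self, cosSol_zero,
    sinSol_zero, mul_one, mul_zero, add_zero] at h₀ h₁
  rw [h₁, h₀]

theorem MemH2.eqOn_dirichletSol (hκ : κ ≠ 0) (hL : 0 < L) (hS : sinSol κ L ≠ 0) (hf : MemH2 L f)
    (h : secondDeriv L f =ᵐ[volume.restrict (Icc 0 L)] fun t => κ ^ 2 * f t) :
    EqOn f (dirichletSol κ L (f 0) (f L)) (Icc 0 L) := by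
  intro t ht
  rw [dirichletSol, hf.eq_cosSol_add_sinSol hκ hL h ht,
    hf.eq_cosSol_add_sinSol hκ hL h (right_mem_Icc.2 hL.le), sinSol_sub hκ]
  field_simp
  ring

theorem continuous_dirichletSol (κ : ℂ) (L : ℝ) (a b : ℂ) : Continuous (dirichletSol κ L a b) := by
  have := continuous_sinSol κ
  unfold dirichletSol
  fun_prop

theorem dirichletSol_eq_add (κ : ℂ) (L : ℝ) (a b : ℂ) (t : ℝ) :
    dirichletSol κ L a b t = a * dirichletSol κ L 1 0 t + b * dirichletSol κ L 0 1 t := by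
  simp only [dirichletSol]
  ring

theorem dirichletSol_left (hS : sinSol κ L ≠ 0) (a b : ℂ) : dirichletSol κ L a b 0 = a := by
  simp [dirichletSol, sinSol_zero, hS]

theorem dirichletSol_right (hS : sinSol κ L ≠ 0) (a b : ℂ) : dirichletSol κ L a b L = b := by
  simp [dirichletSol, sinSol_zero, hS]

theorem hasDerivAt_dirichletSol (hκ : κ ≠ 0) (L : ℝ) (a b : ℂ) (t : ℝ) :
    HasDerivAt (dirichletSol κ L a b) ((b * cosSol κ t - a * cosSol κ (L - t)) / sinSol κ L) t := by
  refine (((((hasDerivAt_sinSol hκ (L - t)).comp_const_sub L t).const_mul a).add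
    ((hasDerivAt_sinSol hκ t).const_mul b)).div_const (sinSol κ L)).congr_deriv ?_
  ring

theorem derivWithin_dirichletSol_left (hκ : κ ≠ 0) (hL : 0 < L) (a b : ℂ) :
    derivWithin (dirichletSol κ L a b) (Icc 0 L) 0 = (b - cosSol κ L * a) / sinSol κ L := by
  rw [(hasDerivAt_dirichletSol hκ L a b 0).hasDerivWithinAt.derivWithin
    (uniqueDiffOn_Icc hL 0 (left_mem_Icc.2 hL.le)), cosSol_zero, sub_zero]
  ring

theorem neg_derivWithin_dirichletSol_right (hκ : κ ≠ 0) (hL : 0 < L) (a b : ℂ) :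
    -derivWithin (dirichletSol κ L a b) (Icc 0 L) L = (a - cosSol κ L * b) / sinSol κ L := by
  rw [(hasDerivAt_dirichletSol hκ L a b L).hasDerivWithinAt.derivWithin
    (uniqueDiffOn_Icc hL L (right_mem_Icc.2 hL.le)), sub_self, cosSol_zero]
  ring

theorem hasDerivAt_deriv_dirichletSol (hκ : κ ≠ 0) (L : ℝ) (a b : ℂ) (t : ℝ) :
    HasDerivAt (fun t => (b * cosSol κ t - a * cosSol κ (L - t)) / sinSol κ L)
      (κ ^ 2 * dirichletSol κ L a b t) t := by
  refine ((((hasDerivAt_cosSol hκ t).const_mul b).sub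
    (((hasDerivAt_cosSol hκ (L - t)).comp_const_sub L t).const_mul a)).div_const
      (sinSol κ L)).congr_deriv ?_
  rw [dirichletSol]
  ring

theorem memH2_dirichletSol (hκ : κ ≠ 0) (hL : 0 < L) (a b : ℂ) :
    MemH2 L (dirichletSol κ L a b) :=
  MemH2.of_contDiff hL (hasDerivAt_dirichletSol hκ L a b) (hasDerivAt_deriv_dirichletSol hκ L a b)
    ((continuous_dirichletSol κ L a b).const_mul _)

theorem secondDeriv_dirichletSol_ae_eq (hκ : κ ≠ 0) (hL : 0 < L) (a b : ℂ) :
    secondDeriv L (dirichletSol κ L a b) =ᵐ[volume.restrict (Icc 0 L)]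
      fun t => κ ^ 2 * dirichletSol κ L a b t :=
  secondDeriv_ae_eq hL (fun t _ => (hasDerivAt_dirichletSol hκ L a b t).hasDerivWithinAt)
    (Filter.Eventually.of_forall (hasDerivAt_deriv_dirichletSol hκ L a b))

theorem isH2Rep_dirichletSol (hκ : κ ≠ 0) (hL : 0 < L) {a b : ℂ}
    {u : Lp ℂ 2 (volume.restrict (Icc 0 L))}
    (hu : u =ᵐ[volume.restrict (Icc 0 L)] dirichletSol κ L a b) :
    IsH2Rep L (dirichletSol κ L a b) u (-κ ^ 2 • u) := by
  refine ⟨memH2_dirichletSol hκ hL a b, hu, ?_⟩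
  filter_upwards [Lp.coeFn_smul (-κ ^ 2) u, hu, secondDeriv_dirichletSol_ae_eq hκ hL a b]
    with t h₁ h₂ h₃
  rw [h₁, Pi.smul_apply, h₂, Pi.neg_apply, h₃, smul_eq_mul, neg_mul]

theorem IsH2Rep.eqOn_dirichletSol (hκ : κ ≠ 0) (hL : 0 < L) (hS : sinSol κ L ≠ 0)
    {u : Lp ℂ 2 (volume.restrict (Icc 0 L))} (h : IsH2Rep L f u (-κ ^ 2 • u)) :
    EqOn f (dirichletSol κ L (f 0) (f L)) (Icc 0 L) := by
  refine h.memH2.eqOn_dirichletSol hκ hL hS ?_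
  filter_upwards [Lp.coeFn_smul (-κ ^ 2) u, h.fst_ae_eq, h.snd_ae_eq] with t h₁ h₂ h₃
  rw [← neg_inj, ← Pi.neg_apply, ← h₃, h₁, Pi.smul_apply, h₂, smul_eq_mul, neg_mul]

theorem norm_dirichletSol_le {K M : ℝ} (hS : sinSol κ L ≠ 0)
    (hK : ∀ t ∈ Icc 0 L, ‖sinSol κ t‖ ≤ K * ‖sinSol κ L‖) {a b : ℂ} (ha : ‖a‖ ≤ M) (hb : ‖b‖ ≤ M)
    {t : ℝ} (ht : t ∈ Icc 0 L) : ‖dirichletSol κ L a b t‖ ≤ 2 * K * M := by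
  rw [dirichletSol, norm_div, div_le_iff₀ (norm_pos_iff.2 hS)]
  have hM : 0 ≤ M := (norm_nonneg a).trans ha
  calc ‖a * sinSol κ (L - t) + b * sinSol κ t‖
      ≤ ‖a‖ * ‖sinSol κ (L - t)‖ + ‖b‖ * ‖sinSol κ t‖ := by
        simpa only [norm_mul] using norm_add_le (a * sinSol κ (L - t)) (b * sinSol κ t)
    _ ≤ M * (K * ‖sinSol κ L‖) + M * (K * ‖sinSol κ L‖) := by
        gcongr
        · exact hK _ ⟨sub_nonneg.2 ht.2, sub_le_self L ht.1⟩
        · exact hK t ht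
    _ = 2 * K * M * ‖sinSol κ L‖ := by ring

end Edge

/-! ### Reduction to a difference equation on the vertices -/

section Discrete

variable {V : Type*} {G : SimpleGraph V} {ℓ : G.edgeSet → ℝ} {κ : ℂ} {x : V → ℂ} {v : V}
  {e : G.edgeSet}

/-- The function on the metric graph that interpolates the vertex values `x` on each edge by the
solution of `f'' = κ² f`. -/
def interpolation (o : Orientation G) (ℓ : G.edgeSet → ℝ) (κ : ℂ) (x : V → ℂ)
    (e : G.edgeSet) : ℝ → ℂ :=
  dirichletSol κ (ℓ e) (x (o.tail e)) (x (o.head e))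

theorem memLp_dirichletSol (κ : ℂ) (L : ℝ) (a b : ℂ) :
    MemLp (dirichletSol κ L a b) 2 (volume.restrict (Icc 0 L)) :=
  memLp_of_continuousOn (continuous_dirichletSol κ L a b).continuousOn

/-- The interpolation on the edge `e` as a linear map into `L²(e)`. -/
def interpolationLp (o : Orientation G) (ℓ : G.edgeSet → ℝ) (κ : ℂ) (e : G.edgeSet) :
    (V → ℂ) →ₗ[ℂ] Lp ℂ 2 (volume.restrict (Icc 0 (ℓ e))) :=
  (LinearMap.proj (o.tail e)).smulRight (memLp_dirichletSol κ (ℓ e) 1 0).toLp +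
    (LinearMap.proj (o.head e)).smulRight (memLp_dirichletSol κ (ℓ e) 0 1).toLp

theorem interpolationLp_ae_eq (o : Orientation G) (κ : ℂ) (x : V → ℂ) (e : G.edgeSet) :
    interpolationLp o ℓ κ e x =ᵐ[volume.restrict (Icc 0 (ℓ e))] interpolation o ℓ κ x e := by
  set A := (memLp_dirichletSol κ (ℓ e) 1 0).toLp
  set B := (memLp_dirichletSol κ (ℓ e) 0 1).toLp
  have hAB : interpolationLp o ℓ κ e x = x (o.tail e) • A + x (o.head e) • B := rfl
  rw [hAB]
  filter_upwards [Lp.coeFn_add (x (o.tail e) • A) (x (o.head e) • B),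
    Lp.coeFn_smul (x (o.tail e)) A, Lp.coeFn_smul (x (o.head e)) B,
    (memLp_dirichletSol κ (ℓ e) 1 0).coeFn_toLp,
    (memLp_dirichletSol κ (ℓ e) 0 1).coeFn_toLp] with t h₁ h₂ h₃ h₄ h₅
  rw [h₁, Pi.add_apply, h₂, h₃, Pi.smul_apply, Pi.smul_apply, h₄, h₅, interpolation,
    dirichletSol_eq_add κ (ℓ e) (x _), smul_eq_mul, smul_eq_mul]

/-- The equation satisfied by the vertex values of a solution of `f'' = κ² f` subject to the
Kirchhoff conditions. Each summand is the outgoing derivative along an edge at `v`. -/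
def DiscreteSolution [G.LocallyFinite] (ℓ : G.edgeSet → ℝ) (κ : ℂ) (x : V → ℂ) : Prop :=
  ∀ v, ∑ w : G.neighborSet v, (x w - cosSol κ (ℓ (starEdge v w)) * x v) /
    sinSol κ (ℓ (starEdge v w)) = 0

theorem DiscreteSolution.zero [G.LocallyFinite] (ℓ : G.edgeSet → ℝ) (κ : ℂ) :
    DiscreteSolution ℓ κ (0 : V → ℂ) := fun v => by simp

theorem DiscreteSolution.add [G.LocallyFinite] {y : V → ℂ} (hx : DiscreteSolution ℓ κ x)
    (hy : DiscreteSolution ℓ κ y) : DiscreteSolution ℓ κ (x + y) := fun v => by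
  simp only [Pi.add_apply, mul_add, add_sub_add_comm, add_div, Finset.sum_add_distrib, hx v, hy v,
    add_zero]

theorem DiscreteSolution.smul [G.LocallyFinite] (c : ℂ) (hx : DiscreteSolution ℓ κ x) :
    DiscreteSolution ℓ κ (c • x) := fun v => by
  simp only [Pi.smul_apply, smul_eq_mul, mul_left_comm _ c, ← mul_sub, mul_div_assoc,
    ← Finset.mul_sum, hx v, mul_zero]

/-- The vertex values of the square integrable solutions of `f'' = κ² f` subject to the Kirchhoff
conditions. -/
def solutionSpace [G.LocallyFinite] (o : Orientation G) (ℓ : G.edgeSet → ℝ) (κ : ℂ) :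
    Submodule ℂ (V → ℂ) where
  carrier := {x | DiscreteSolution ℓ κ x ∧ Memℓp (fun e => interpolationLp o ℓ κ e x) 2}
  zero_mem' := ⟨DiscreteSolution.zero ℓ κ, by simp only [map_zero]; exact zero_memℓp⟩
  add_mem' hx hy := ⟨hx.1.add hy.1, by simp only [map_add]; exact hx.2.add hy.2⟩
  smul_mem' c _ hx := ⟨hx.1.smul c, by simp only [map_smul]; exact hx.2.const_smul c⟩

variable {o : Orientation G} (hS : ∀ e, sinSol κ (ℓ e) ≠ 0) (hκ : κ ≠ 0) (hℓ : ∀ e, 0 < ℓ e)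

include hS in
theorem vertexValue_interpolation (h : v ∈ e.1) :
    vertexValue o ℓ (interpolation o ℓ κ x) e v = x v := by
  obtain rfl | rfl := o.mem_iff.1 h
  · rw [vertexValue_tail, interpolation, dirichletSol_left (hS e)]
  · rw [vertexValue_head, interpolation, dirichletSol_right (hS e)]

include hκ hℓ in
theorem vertexDeriv_interpolation (v : V) (w : G.neighborSet v) :
    vertexDeriv o ℓ (interpolation o ℓ κ x) (starEdge v w) v =
      (x w - cosSol κ (ℓ (starEdge v w)) * x v) / sinSol κ (ℓ (starEdge v w)) := by
  set e := starEdge v w with he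
  obtain ⟨ht, hh⟩ | ⟨ht, hh⟩ := Sym2.eq_iff.1 ((o.mk_eq e).trans (congrArg Subtype.val he))
  · conv_lhs => rw [← ht]
    rw [vertexDeriv_tail, interpolation, derivWithin_dirichletSol_left hκ (hℓ e), ht, hh]
  · conv_lhs => rw [← hh]
    rw [vertexDeriv_head, interpolation, neg_derivWithin_dirichletSol_right hκ (hℓ e), ht, hh]

include hS hκ hℓ in
theorem kirchhoff_interpolation_iff [G.LocallyFinite] :
    (∀ v, Kirchhoff o ℓ (interpolation o ℓ κ x) v) ↔ DiscreteSolution ℓ κ x := by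
  refine forall_congr' fun v => ?_
  simp only [Kirchhoff, vertexDeriv_interpolation hκ hℓ, vertexValue_interpolation hS
    (mem_starEdge v _), implies_true, true_and]

include hS in
theorem eq_zero_of_interpolationLp_eq_zero (hℓ : ∀ e, 0 < ℓ e)
    (hG : ∀ v, Nonempty (G.neighborSet v)) (h : ∀ e, interpolationLp o ℓ κ e x = 0) : x = 0 := by
  funext v
  obtain ⟨w⟩ := hG v
  set e := starEdge v w
  have h₀ : interpolation o ℓ κ x e =ᵐ[volume.restrict (Icc 0 (ℓ e))] 0 :=
    (interpolationLp_ae_eq o κ x e).symm.trans (h e ▸ Lp.coeFn_zero _ _ _)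
  have h₁ : EqOn (interpolation o ℓ κ x e) 0 (Icc 0 (ℓ e)) :=
    Measure.eqOn_Icc_of_ae_eq volume (hℓ e).ne h₀ (continuous_dirichletSol _ _ _ _).continuousOn
      continuousOn_const
  rw [← vertexValue_interpolation (o := o) hS (mem_starEdge v w) (x := x), vertexValue]
  split_ifs
  · exact h₁ (left_mem_Icc.2 (hℓ e).le)
  · exact h₁ (right_mem_Icc.2 (hℓ e).le)

include hS hκ hℓ in
theorem exists_eq_interpolationLp [G.LocallyFinite] (hG : ∀ v, Nonempty (G.neighborSet v))
    {u : L2 G ℓ} (hu : (u, -κ ^ 2 • u) ∈ laplacianGraph o hℓ) :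
    ∃ x ∈ solutionSpace o ℓ κ, ∀ e, interpolationLp o ℓ κ e x = u e := by
  obtain ⟨f, hf, kf⟩ := (mem_laplacianGraph_iff hℓ).1 hu
  set x : V → ℂ := fun v => vertexValue o ℓ f (starEdge v (Classical.choice (hG v))) v
  have hx (e) (v) (hv : v ∈ e.1) : vertexValue o ℓ f e v = x v := by
    obtain ⟨w, rfl⟩ := exists_starEdge_eq hv
    exact (kf v).1 w _
  have hfx (e) : EqOn (f e) (interpolation o ℓ κ x e) (Icc 0 (ℓ e)) := by
    rw [interpolation, ← hx e _ (o.tail_mem e), ← hx e _ (o.head_mem e), vertexValue_tail,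
      vertexValue_head]
    exact (hf e).eqOn_dirichletSol hκ (hℓ e) (hS e)
  have hux (e) : interpolationLp o ℓ κ e x = u e := by
    refine Lp.ext ?_
    filter_upwards [interpolationLp_ae_eq o κ x e, (hf e).fst_ae_eq,
      ae_restrict_mem measurableSet_Icc] with t h₁ h₂ ht
    rw [h₁, h₂, hfx e ht]
  refine ⟨x, ⟨(kirchhoff_interpolation_iff hS hκ hℓ).1 fun v => (kf v).congr hℓ hfx, ?_⟩, hux⟩
  simpa only [hux] using lp.memℓp u

include hS hκ in
theorem rank_deficiencySubspace_eq [G.LocallyFinite] (hG : ∀ v, Nonempty (G.neighborSet v)) :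
    Module.rank ℂ (deficiencySubspace (minimalLaplacian o hℓ) (-κ ^ 2)) =
      Module.rank ℂ (solutionSpace o ℓ κ) := by
  set Φ : solutionSpace o ℓ κ →ₗ[ℂ] L2 G ℓ :=
    { toFun := fun x => ⟨fun e => interpolationLp o ℓ κ e x.1, x.2.2⟩
      map_add' := fun x y => lp.ext (funext fun e => map_add _ x.1 y.1)
      map_smul' := fun c x => lp.ext (funext fun e => map_smul _ c x.1) }
  have hmem (x) : Φ x ∈ deficiencySubspace (minimalLaplacian o hℓ) (-κ ^ 2) :=
    (mem_deficiencySubspace_minimalLaplacian_iff hℓ).2 <| (mem_laplacianGraph_iff hℓ).2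
      ⟨interpolation o ℓ κ x.1,
        fun e => isH2Rep_dirichletSol hκ (hℓ e) (interpolationLp_ae_eq o κ x.1 e),
        (kirchhoff_interpolation_iff hS hκ hℓ).2 x.2.1⟩
  refine (LinearEquiv.ofBijective (Φ.codRestrict _ hmem) ⟨?_, ?_⟩).symm.rank_eq
  · rw [← LinearMap.ker_eq_bot, LinearMap.ker_codRestrict, LinearMap.ker_eq_bot']
    exact fun x hx => Subtype.ext <| eq_zero_of_interpolationLp_eq_zero hS hℓ hG
      fun e => congrFun (congrArg Subtype.val hx) e
  · rintro ⟨u, hu⟩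
    obtain ⟨x, hx, hux⟩ := exists_eq_interpolationLp hS hκ hℓ hG
      ((mem_deficiencySubspace_minimalLaplacian_iff hℓ).1 hu)
    exact ⟨⟨x, hx⟩, Subtype.ext (lp.ext (funext hux))⟩

theorem norm_interpolationLp_sq_le (hS : sinSol κ (ℓ e) ≠ 0) {K M : ℝ} (hℓ : 0 < ℓ e)
    (hK : ∀ t ∈ Icc 0 (ℓ e), ‖sinSol κ t‖ ≤ K * ‖sinSol κ (ℓ e)‖)
    (hM : ∀ v ∈ e.1, ‖x v‖ ≤ M) :
    ‖interpolationLp o ℓ κ e x‖ ^ 2 ≤ (2 * K) ^ 2 * (ℓ e * M ^ 2) := by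
  have hbound (t) (ht : t ∈ Icc 0 (ℓ e)) : ‖interpolation o ℓ κ x e t‖ ≤ 2 * K * M :=
    norm_dirichletSol_le hS hK (hM _ (o.tail_mem e)) (hM _ (o.head_mem e)) ht
  have hae : ∀ᵐ t ∂volume.restrict (Icc 0 (ℓ e)), ‖interpolationLp o ℓ κ e x t‖ ≤ 2 * K * M := by
    filter_upwards [interpolationLp_ae_eq o κ x e, ae_restrict_mem measurableSet_Icc] with t h₁ ht
    exact h₁ ▸ hbound t ht
  have hvol : (measureUnivNNReal (volume.restrict (Icc 0 (ℓ e))) : ℝ) = ℓ e := by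
    change (volume.restrict (Icc 0 (ℓ e)) univ).toReal = ℓ e
    simp [hℓ.le]
  have hnn := (norm_nonneg _).trans (hbound 0 (left_mem_Icc.2 hℓ.le))
  calc ‖interpolationLp o ℓ κ e x‖ ^ 2
      ≤ (ℓ e ^ (2⁻¹ : ℝ) * (2 * K * M)) ^ 2 := by
        gcongr
        simpa [hvol] using Lp.norm_le_of_ae_bound hnn hae
    _ = (2 * K) ^ 2 * (ℓ e * M ^ 2) := by
        rw [mul_pow, ← Real.rpow_natCast (ℓ e ^ _), ← Real.rpow_mul hℓ.le]
        norm_num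
        ring

theorem memℓp_interpolationLp (hS : ∀ e, sinSol κ (ℓ e) ≠ 0) (hℓ : ∀ e, 0 < ℓ e) {K : ℝ}
    (hK : ∀ e, ∀ t ∈ Icc 0 (ℓ e), ‖sinSol κ t‖ ≤ K * ‖sinSol κ (ℓ e)‖)
    {M : G.edgeSet → ℝ} (hM : ∀ e, ∀ v ∈ e.1, ‖x v‖ ≤ M e)
    (hsum : Summable fun e => ℓ e * M e ^ 2) :
    Memℓp (fun e => interpolationLp o ℓ κ e x) 2 := by
  rw [memℓp_gen_iff (by norm_num)]
  simp only [ENNReal.toReal_ofNat, Real.rpow_ofNat]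
  exact Summable.of_nonneg_of_le (fun e => by positivity)
    (fun e => norm_interpolationLp_sq_le (hS e) (hℓ e) (hK e) (hM e)) (hsum.mul_left _)

end Discrete

/-! ### Short edges -/

section ShortEdge

variable {κ : ℂ} {L : ℝ}

theorem norm_exp_mul_sub_one_sub_id_le (hκ : ‖κ‖ = 1) (h₀ : 0 ≤ L) (h₁ : L ≤ 1) :
    ‖Complex.exp (κ * L) - 1 - κ * L‖ ≤ L ^ 2 := by
  have h : ‖κ * L‖ = L := by rw [norm_mul, hκ, one_mul, Complex.norm_of_nonneg h₀]
  simpa only [h] using Complex.norm_exp_sub_one_sub_id_le (x := κ * L) (h.le.trans h₁)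

theorem norm_sinSol_sub_le (hκ : ‖κ‖ = 1) (h₀ : 0 ≤ L) (h₁ : L ≤ 1) :
    ‖sinSol κ L - L‖ ≤ L ^ 2 := by
  have hκ₀ : κ ≠ 0 := norm_ne_zero_iff.1 (hκ ▸ one_ne_zero)
  have e₁ := norm_exp_mul_sub_one_sub_id_le hκ h₀ h₁
  have e₂ := norm_exp_mul_sub_one_sub_id_le ((norm_neg κ).trans hκ) h₀ h₁
  have h : sinSol κ L - L = ((Complex.exp (κ * L) - 1 - κ * L) -
      (Complex.exp (-κ * L) - 1 - -κ * L)) / (2 * κ) := by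
    rw [sinSol, Complex.sinh, neg_mul]
    field_simp
    ring
  rw [h, norm_div, norm_mul, hκ, RCLike.norm_ofNat, mul_one, div_le_iff₀ two_pos]
  exact (norm_sub_le _ _).trans (by linarith)

theorem norm_cosSol_sub_le (hκ : ‖κ‖ = 1) (h₀ : 0 ≤ L) (h₁ : L ≤ 1) :
    ‖cosSol κ L - 1‖ ≤ L ^ 2 := by
  have e₁ := norm_exp_mul_sub_one_sub_id_le hκ h₀ h₁
  have e₂ := norm_exp_mul_sub_one_sub_id_le ((norm_neg κ).trans hκ) h₀ h₁
  have h : cosSol κ L - 1 = ((Complex.exp (κ * L) - 1 - κ * L) +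
      (Complex.exp (-κ * L) - 1 - -κ * L)) / 2 := by
    rw [cosSol, Complex.cosh, neg_mul]
    ring
  rw [h, norm_div, RCLike.norm_ofNat, div_le_iff₀ two_pos]
  exact (norm_add_le _ _).trans (by linarith)

theorem norm_sinSol_le (hκ : ‖κ‖ = 1) (h₀ : 0 ≤ L) (h₁ : L ≤ 1 / 8) :
    ‖sinSol κ L‖ ≤ 3 / 2 * L := by
  have h := norm_sinSol_sub_le hκ h₀ (by linarith)
  have h' := norm_le_norm_add_norm_sub' (sinSol κ L) L
  rw [Complex.norm_of_nonneg h₀] at h'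
  nlinarith

theorem le_norm_sinSol (hκ : ‖κ‖ = 1) (h₀ : 0 ≤ L) (h₁ : L ≤ 1 / 8) :
    7 / 8 * L ≤ ‖sinSol κ L‖ := by
  have h := norm_sinSol_sub_le hκ h₀ (by linarith)
  have h' := norm_le_norm_add_norm_sub (sinSol κ L) (L : ℂ)
  rw [Complex.norm_of_nonneg h₀] at h'
  nlinarith

theorem sinSol_ne_zero (hκ : ‖κ‖ = 1) (h₀ : 0 < L) (h₁ : L ≤ 1 / 8) : sinSol κ L ≠ 0 := by
  have := le_norm_sinSol hκ h₀.le h₁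
  exact norm_pos_iff.1 (by linarith)

theorem norm_inv_sinSol_le (hκ : ‖κ‖ = 1) (h₀ : 0 < L) (h₁ : L ≤ 1 / 8) :
    ‖(sinSol κ L)⁻¹‖ ≤ 2 / L := by
  have := le_norm_sinSol hκ h₀.le h₁
  rw [norm_inv, ← one_div, div_le_div_iff₀ (by linarith) h₀]
  linarith

theorem norm_cosSol_div_sinSol_sub_le (hκ : ‖κ‖ = 1) (h₀ : 0 < L) (h₁ : L ≤ 1 / 8) :
    ‖cosSol κ L / sinSol κ L - (1 / L : ℝ)‖ ≤ 3 := by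
  have hsin := sinSol_ne_zero hκ h₀ h₁
  have hL : (L : ℂ) ≠ 0 := by exact_mod_cast h₀.ne'
  have h : cosSol κ L / sinSol κ L - (1 / L : ℝ) =
      ((cosSol κ L - 1) * L - (sinSol κ L - L)) / L * (sinSol κ L)⁻¹ := by
    push_cast
    field_simp
    ring
  have hnum : ‖(cosSol κ L - 1) * L - (sinSol κ L - L)‖ ≤ L ^ 2 * L + L ^ 2 := by
    refine (norm_sub_le _ _).trans (add_le_add ?_ (norm_sinSol_sub_le hκ h₀.le (by linarith)))
    rw [norm_mul, Complex.norm_of_nonneg h₀.le]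
    gcongr
    exact norm_cosSol_sub_le hκ h₀.le (by linarith)
  calc ‖cosSol κ L / sinSol κ L - (1 / L : ℝ)‖ ≤ (L ^ 2 * L + L ^ 2) / L * (2 / L) := by
        rw [h, norm_mul, norm_div, Complex.norm_of_nonneg h₀.le]
        gcongr
        exact norm_inv_sinSol_le hκ h₀ h₁
    _ = 2 * L + 2 := by field_simp
    _ ≤ 3 := by linarith

theorem norm_cosSol_div_sinSol_le (hκ : ‖κ‖ = 1) (h₀ : 0 < L) (h₁ : L ≤ 1 / 8) :
    ‖cosSol κ L / sinSol κ L‖ ≤ 2 / L := by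
  have h := norm_cosSol_div_sinSol_sub_le hκ h₀ h₁
  have h' := norm_le_norm_add_norm_sub' (cosSol κ L / sinSol κ L) (1 / L : ℝ)
  rw [Complex.norm_of_nonneg (one_div_pos.2 h₀).le] at h'
  have : 8 ≤ 1 / L := by rw [le_div_iff₀ h₀]; linarith
  calc _ ≤ 1 / L + 1 / L := by linarith
    _ = 2 / L := by ring

theorem re_cosSol_div_sinSol_pos (hκ : ‖κ‖ = 1) (h₀ : 0 < L) (h₁ : L ≤ 1 / 8) :
    0 < (cosSol κ L / sinSol κ L).re := by
  have h := (Complex.abs_re_le_norm _).trans (norm_cosSol_div_sinSol_sub_le hκ h₀ h₁)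
  rw [Complex.sub_re, Complex.ofReal_re] at h
  have : 8 ≤ 1 / L := by rw [le_div_iff₀ h₀]; linarith
  linarith [(abs_le.1 h).1]

end ShortEdge

/-! ### Partitions of the labels and edge lengths -/

/-- The length of the edges of level `k` between vertices of different classes. A solution grows at
most by a factor `100` from one sphere to the next, and `10⁻⁶` per level compensates for it. -/
def longLength (k : ℕ) : ℝ := (1 / 10 ^ 6) ^ (k + 1)

/-- The length of the edges of level `k` between vertices of the same class. -/
def shortLength (k : ℕ) : ℝ := longLength k ^ 2

theorem longLength_pos (k : ℕ) : 0 < longLength k := by unfold longLength; positivity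

theorem shortLength_pos (k : ℕ) : 0 < shortLength k := pow_pos (longLength_pos k) 2

theorem longLength_antitone : Antitone longLength := fun _ _ h =>
  pow_le_pow_of_le_one (by norm_num) (by norm_num) (Nat.succ_le_succ h)

theorem shortLength_antitone : Antitone shortLength := fun _ k h =>
  pow_le_pow_left₀ (longLength_pos k).le (longLength_antitone h) 2

theorem longLength_le_eighth (k : ℕ) : longLength k ≤ 1 / 8 :=
  (longLength_antitone (Nat.zero_le k)).trans (by norm_num [longLength])

theorem shortLength_le_longLength (k : ℕ) : shortLength k ≤ longLength k :=
  pow_le_of_le_one (longLength_pos k).le ((longLength_le_eighth k).trans (by norm_num)) two_ne_zero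

theorem shortLength_le_eighth (k : ℕ) : shortLength k ≤ 1 / 8 :=
  (shortLength_le_longLength k).trans (longLength_le_eighth k)

theorem add_one_mul_longLength_le (k : ℕ) : (k + 1) * longLength k ≤ 1 / 10 ^ 5 := by
  have h : (k + 1 : ℝ) ≤ 2 ^ (k + 1) := by exact_mod_cast (k + 1).lt_two_pow_self.le
  calc (k + 1) * longLength k ≤ 2 ^ (k + 1) * longLength k :=
        mul_le_mul_of_nonneg_right h (longLength_pos k).le
    _ = (2 / 10 ^ 6) ^ (k + 1) := by rw [longLength, ← mul_pow]; norm_num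
    _ ≤ 2 / 10 ^ 6 := pow_le_of_le_one (by norm_num) (by norm_num) (by omega)
    _ ≤ 1 / 10 ^ 5 := by norm_num

/-- A partition of the set `ℕ` of labels, encoded by the map that sends a label to the least label
of its class. -/
structure LabelPartition where
  rep : ℕ → ℕ
  rep_le : ∀ i, rep i ≤ i
  rep_rep : ∀ i, rep (rep i) = rep i

/-- The antitree with sphere numbers `n + 1`. -/
abbrev linearAntitree : SimpleGraph (Σ n, Fin (n + 1)) := antitree (fun n => n + 1)

namespace LabelPartition

variable (P : LabelPartition)

/-- The length of an edge of level `k`, that is between the spheres `k - 1` and `k`, joining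
vertices with labels `i` and `j`. -/
def levelLength (k i j : ℕ) : ℝ :=
  if P.rep i = P.rep j then shortLength k else longLength k

theorem levelLength_pos (k i j : ℕ) : 0 < P.levelLength k i j := by
  unfold levelLength
  split_ifs
  exacts [shortLength_pos k, longLength_pos k]

theorem levelLength_le (k i j : ℕ) : P.levelLength k i j ≤ longLength k := by
  unfold levelLength
  split_ifs
  exacts [shortLength_le_longLength k, le_rfl]

theorem levelLength_le_eighth (k i j : ℕ) : P.levelLength k i j ≤ 1 / 8 :=
  (P.levelLength_le k i j).trans (longLength_le_eighth k)

/-- The lengths of the edges of the antitree: an edge is much shorter than the others of its level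
if the labels of its endpoints are in the same class. -/
def edgeLength (e : linearAntitree.edgeSet) : ℝ :=
  Sym2.lift ⟨fun v w : (Σ n, Fin (n + 1)) => P.levelLength (max v.1 w.1) v.2 w.2, fun v w => by
    simp only [levelLength, max_comm, eq_comm]⟩ e.1

theorem edgeLength_eq (o : Orientation linearAntitree) (e : linearAntitree.edgeSet) :
    P.edgeLength e =
      P.levelLength (max (o.tail e).1 (o.head e).1) (o.tail e).2 (o.head e).2 := by
  rw [edgeLength, ← o.mk_eq e]
  rfl

theorem edgeLength_pos (e : linearAntitree.edgeSet) : 0 < P.edgeLength e := by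
  rw [P.edgeLength_eq (Classical.arbitrary _) e]
  exact P.levelLength_pos _ _ _

theorem edgeLength_le_eighth (e : linearAntitree.edgeSet) : P.edgeLength e ≤ 1 / 8 := by
  rw [P.edgeLength_eq (Classical.arbitrary _) e]
  exact P.levelLength_le_eighth _ _ _

theorem sinSol_edgeLength_ne_zero {κ : ℂ} (hκ : ‖κ‖ = 1) (e : linearAntitree.edgeSet) :
    sinSol κ (P.edgeLength e) ≠ 0 :=
  sinSol_ne_zero hκ (P.edgeLength_pos e) (P.edgeLength_le_eighth e)

end LabelPartition

/-! ### The difference equation on the antitree -/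

theorem sum_neighborSet_antitree (s : ℕ → ℕ) (φ : (Σ n, Fin (s n)) → ℂ) (v : Σ n, Fin (s n)) :
    ∑ w : (antitree s).neighborSet v, φ w =
      ∑ m ∈ Finset.range (v.1 + 2) with v.1 + 1 = m ∨ m + 1 = v.1, ∑ j, φ ⟨m, j⟩ := by
  rw [← Finset.sum_sigma _ (fun _ => Finset.univ) φ]
  refine (Finset.sum_subtype _ (fun w => ?_) φ).symm
  simp only [Finset.mem_sigma, Finset.mem_filter, Finset.mem_range, Finset.mem_univ, and_true,
    SimpleGraph.mem_neighborSet, antitree]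
  omega

/-- The vertex with label `j` in the `n`-th sphere. The label is read modulo `n + 1`, so that it
can be an arbitrary natural number. -/
def vtx (n j : ℕ) : Σ n, Fin (n + 1) := ⟨n, Fin.ofNat (n + 1) j⟩

theorem vtx_val (n : ℕ) (i : Fin (n + 1)) : vtx n i = ⟨n, i⟩ := by
  simp [vtx]

theorem vtx_snd {n j : ℕ} (h : j < n + 1) : ((vtx n j).2 : ℕ) = j := by
  simp [vtx, Nat.mod_eq_of_lt h]

theorem sum_fin_eq_sum_vtx (φ : (Σ n, Fin (n + 1)) → ℂ) (n : ℕ) :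
    ∑ j : Fin (n + 1), φ ⟨n, j⟩ = ∑ j ∈ Finset.range (n + 1), φ (vtx n j) := by
  rw [← Fin.sum_univ_eq_sum_range (fun j => φ (vtx n j))]
  exact Finset.sum_congr rfl fun j _ => by rw [vtx_val]

theorem sum_neighborSet_linearAntitree (φ : (Σ n, Fin (n + 1)) → ℂ) (v : Σ n, Fin (n + 1)) :
    ∑ w : linearAntitree.neighborSet v, φ w =
      ∑ j ∈ Finset.range (v.1 + 2), φ (vtx (v.1 + 1) j) +
        ∑ j ∈ Finset.range v.1, φ (vtx (v.1 - 1) j) := by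
  refine (sum_neighborSet_antitree _ φ v).trans ?_
  obtain ⟨n, i⟩ := v
  cases n with
  | zero =>
    have h : {m ∈ Finset.range 2 | 1 = m ∨ m + 1 = 0} = {1} := by decide
    simp only [zero_add, h, Finset.sum_singleton, sum_fin_eq_sum_vtx, Finset.range_zero,
      Finset.sum_empty, add_zero, Nat.reduceAdd]
  | succ n =>
    have h : {m ∈ Finset.range (n + 1 + 2) | n + 1 + 1 = m ∨ m + 1 = n + 1} = {n + 2, n} := by
      ext m
      simp only [Finset.mem_filter, Finset.mem_range, Finset.mem_insert, Finset.mem_singleton]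
      omega
    simp only [h, Finset.sum_pair (show n + 2 ≠ n by omega), sum_fin_eq_sum_vtx,
      Nat.add_sub_cancel, add_assoc, Nat.reduceAdd]

namespace LabelPartition

variable (P : LabelPartition) {κ : ℂ}

/-- The coefficient `1 / sinSol` of the difference equation between vertices with labels `i` and
`j` joined by an edge of level `k`. -/
def coupling (κ : ℂ) (k i j : ℕ) : ℂ := (sinSol κ (P.levelLength k i j))⁻¹

/-- The contribution `cosSol / sinSol` of an edge of level `k` joining vertices with labels `i` and
`j` to the diagonal coefficients of the difference equation. -/
def potential (κ : ℂ) (k i j : ℕ) : ℂ :=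
  cosSol κ (P.levelLength k i j) / sinSol κ (P.levelLength k i j)

/-- The diagonal coefficient of the difference equation at the vertex with label `i` in the `n`-th
sphere. -/
def totalPotential (κ : ℂ) (n i : ℕ) : ℂ :=
  ∑ j ∈ Finset.range (n + 2), P.potential κ (n + 1) i j +
    ∑ j ∈ Finset.range n, P.potential κ n i j

/-- The difference equation at the vertex with label `i` in the `n`-th sphere, where `y₀`, `y₁`,
`y₂` are the values on the spheres `n - 1`, `n`, `n + 1`. -/
def SphereEquation (κ : ℂ) (n i : ℕ) (y₀ y₁ y₂ : ℕ → ℂ) : Prop :=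
  ∑ j ∈ Finset.range (n + 2), P.coupling κ (n + 1) i j * y₂ j +
    ∑ j ∈ Finset.range n, P.coupling κ n i j * y₀ j = P.totalPotential κ n i * y₁ i

variable {P}

theorem sum_neighborSet_eq (x : (Σ n, Fin (n + 1)) → ℂ) (v : Σ n, Fin (n + 1)) :
    ∑ w : linearAntitree.neighborSet v, (x w - cosSol κ (P.edgeLength (starEdge v w)) * x v) /
        sinSol κ (P.edgeLength (starEdge v w)) =
      ∑ j ∈ Finset.range (v.1 + 2), P.coupling κ (v.1 + 1) v.2 j * x (vtx (v.1 + 1) j) +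
        ∑ j ∈ Finset.range v.1, P.coupling κ v.1 v.2 j * x (vtx (v.1 - 1) j) -
          P.totalPotential κ v.1 v.2 * x v := by
  set φ : (Σ n, Fin (n + 1)) → ℂ := fun w => P.coupling κ (max v.1 w.1) v.2 w.2 * x w -
    P.potential κ (max v.1 w.1) v.2 w.2 * x v with hφ
  have hterm (w : linearAntitree.neighborSet v) :
      (x w - cosSol κ (P.edgeLength (starEdge v w)) * x v) /
        sinSol κ (P.edgeLength (starEdge v w)) = φ w := by
    rw [show P.edgeLength (starEdge v w) = P.levelLength (max v.1 w.1.1) v.2 w.1.2 from rfl]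
    simp only [hφ, coupling, potential]
    ring
  have hup : ∀ j ∈ Finset.range (v.1 + 2), φ (vtx (v.1 + 1) j) =
      P.coupling κ (v.1 + 1) v.2 j * x (vtx (v.1 + 1) j) -
        P.potential κ (v.1 + 1) v.2 j * x v := fun j hj => by
    simp only [hφ, vtx_snd (Finset.mem_range.1 hj)]
    rw [show max v.1 (vtx (v.1 + 1) j).1 = v.1 + 1 from max_eq_right (Nat.le_succ _)]
  have hdown : ∀ j ∈ Finset.range v.1, φ (vtx (v.1 - 1) j) =
      P.coupling κ v.1 v.2 j * x (vtx (v.1 - 1) j) - P.potential κ v.1 v.2 j * x v := fun j hj => by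
    have hj := Finset.mem_range.1 hj
    simp only [hφ, vtx_snd (show j < v.1 - 1 + 1 by omega)]
    rw [show max v.1 (vtx (v.1 - 1) j).1 = v.1 from max_eq_left (Nat.sub_le _ _)]
  rw [Finset.sum_congr rfl fun w _ => hterm w, sum_neighborSet_linearAntitree,
    Finset.sum_congr rfl hup, Finset.sum_congr rfl hdown, totalPotential]
  simp only [Finset.sum_sub_distrib, ← Finset.sum_mul]
  ring

theorem discreteSolution_iff {x : (Σ n, Fin (n + 1)) → ℂ} :
    DiscreteSolution P.edgeLength κ x ↔
      ∀ n, ∀ i < n + 1, P.SphereEquation κ n i (fun j => x (vtx (n - 1) j))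
        (fun j => x (vtx n j)) (fun j => x (vtx (n + 1) j)) := by
  simp only [DiscreteSolution, sum_neighborSet_eq, sub_eq_zero, SphereEquation, Sigma.forall,
    Fin.forall_iff]
  refine forall₃_congr fun n i hi => ?_
  rw [← vtx_val n ⟨i, hi⟩]

/-! ### The linear system for the values on a sphere -/

section Classes

variable (P : LabelPartition)

/-- The sum of `y` over the labels `j < m` in the class `c`. -/
def classSum (m c : ℕ) (y : ℕ → ℂ) : ℂ := ∑ j ∈ Finset.range m with P.rep j = c, y j

/-- The number of labels `j < m` in the class `c`. -/
def classCard (m c : ℕ) : ℕ := {j ∈ Finset.range m | P.rep j = c}.card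

/-- The classes that contain a label `j < m`, each given by its least label. -/
def classes (m : ℕ) : Finset ℕ := {c ∈ Finset.range m | P.rep c = c}

variable {P} {m c : ℕ} {y : ℕ → ℂ}

theorem mem_classes : c ∈ P.classes m ↔ c < m ∧ P.rep c = c := by
  simp [classes]

theorem rep_mem_classes {j : ℕ} (hj : P.rep j < m) : P.rep j ∈ P.classes m :=
  mem_classes.2 ⟨hj, P.rep_rep j⟩

theorem mapsTo_rep_classes : MapsTo P.rep (Finset.range m) (P.classes m) := fun j hj =>
  rep_mem_classes ((P.rep_le j).trans_lt (Finset.mem_range.1 hj))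

theorem card_classes_le (P : LabelPartition) (m : ℕ) : (P.classes m).card ≤ m :=
  (Finset.card_filter_le _ _).trans (Finset.card_range m).le

theorem classCard_pos (h : c ∈ P.classes m) : 0 < P.classCard m c :=
  Finset.card_pos.2 ⟨c, by simpa [classes] using h⟩

theorem classCard_mono {m' : ℕ} (h : m ≤ m') (c : ℕ) : P.classCard m c ≤ P.classCard m' c :=
  Finset.card_le_card (Finset.filter_subset_filter _ (Finset.range_mono h))

theorem classes_mono {m' : ℕ} (h : m ≤ m') : P.classes m ⊆ P.classes m' :=
  Finset.filter_subset_filter _ (Finset.range_mono h)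

theorem sum_classCard_le {m' : ℕ} (h : m ≤ m') :
    ∑ c ∈ P.classes m, P.classCard m' c ≤ m' := by
  calc ∑ c ∈ P.classes m, P.classCard m' c ≤ ∑ c ∈ P.classes m', P.classCard m' c :=
        Finset.sum_le_sum_of_subset (classes_mono h)
    _ = (Finset.range m').card := (Finset.card_eq_sum_card_fiberwise mapsTo_rep_classes).symm
    _ = m' := Finset.card_range m'

theorem classSum_eq_mul (hy : ∀ j < m, y (P.rep j) = y j) :
    P.classSum m c y = P.classCard m c * y c := by
  rw [classSum, classCard, ← nsmul_eq_mul, ← Finset.sum_const]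
  refine Finset.sum_congr rfl fun j hj => ?_
  obtain ⟨hjm, rfl⟩ := Finset.mem_filter.1 hj
  exact (hy j (Finset.mem_range.1 hjm)).symm

theorem classSum_succ_self (hm : P.rep m = m) : P.classSum (m + 1) m y = y m := by
  refine Finset.sum_eq_single_of_mem m (by simp [hm]) fun j hj hjm => ?_
  obtain ⟨hj, h⟩ := Finset.mem_filter.1 hj
  have := P.rep_le j
  have := Finset.mem_range.1 hj
  omega

theorem sum_range_succ_eq_sum_classSum_add :
    ∑ j ∈ Finset.range (m + 1), y j =
      ∑ c ∈ P.classes m, P.classSum (m + 1) c y + if P.rep m = m then y m else 0 := by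
  rw [← Finset.sum_fiberwise_of_maps_to mapsTo_rep_classes]
  change ∑ c ∈ P.classes (m + 1), P.classSum (m + 1) c y = _
  rw [classes, Finset.range_add_one, Finset.filter_insert]
  split_ifs with hm
  · rw [Finset.sum_insert (by simp), classSum_succ_self hm, add_comm, classes]
  · rw [add_zero, classes]

end Classes

end LabelPartition

theorem rankOne_system_iff {ι K : Type*} [Field K] {s : Finset ι} {r p : K} {F g : ι → K}
    (h₁ : 1 - r ≠ 0) (h₂ : 1 - r + s.card * r ≠ 0) :
    (∀ c ∈ s, (1 - r) * F c + r * (∑ c ∈ s, F c + p) = g c) ↔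
      ∀ c ∈ s, F c = (g c - r * ((∑ c ∈ s, g c + (1 - r) * p) / (1 - r + s.card * r))) /
        (1 - r) := by
  set T := (∑ c ∈ s, g c + (1 - r) * p) / (1 - r + s.card * r)
  have hT : T * (1 - r + s.card * r) = ∑ c ∈ s, g c + (1 - r) * p := div_mul_cancel₀ _ h₂
  suffices h : ((∀ c ∈ s, (1 - r) * F c + r * (∑ c ∈ s, F c + p) = g c) ∨
      ∀ c ∈ s, F c = (g c - r * T) / (1 - r)) → ∑ c ∈ s, F c + p = T by
    refine ⟨fun hF c hc => ?_, fun hF c hc => ?_⟩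
    · rw [← hF c hc, h (.inl hF)]
      field_simp
      ring
    · rw [h (.inr hF), hF c hc]
      field_simp
      ring
  rintro (hF | hF)
  · have hsum := Finset.sum_congr rfl hF
    rw [Finset.sum_add_distrib, ← Finset.mul_sum, Finset.sum_const, nsmul_eq_mul] at hsum
    rw [eq_div_iff h₂]
    linear_combination hsum
  · have hsum : ∑ c ∈ s, F c = (∑ c ∈ s, g c - s.card * (r * T)) / (1 - r) := by
      rw [Finset.sum_congr rfl hF, ← Finset.sum_div, Finset.sum_sub_distrib, Finset.sum_const,
        nsmul_eq_mul]
    rw [hsum]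
    field_simp
    linear_combination -hT

theorem le_norm_one_sub {w : ℂ} (hw : ‖w‖ ≤ 1 / 1000) : 99 / 100 ≤ ‖1 - w‖ := by
  have := norm_sub_norm_le (1 : ℂ) w
  rw [norm_one] at this
  linarith

theorem norm_le_of_mul_le {r : ℂ} {m : ℕ} (hr : ‖r‖ * (m + 1) ≤ 1 / 1000) : ‖r‖ ≤ 1 / 1000 :=
  (le_mul_of_one_le_right (norm_nonneg r) (by linarith [m.cast_nonneg (α := ℝ)])).trans hr

namespace LabelPartition

section SphereSystem

/-- The sum over all labels of the solution of the linear system for the values on a sphere, see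
`sphereSystem_iff`. -/
def sphereTotal (P : LabelPartition) (m : ℕ) (r : ℂ) (g : ℕ → ℂ) (p : ℂ) : ℂ :=
  (∑ c ∈ P.classes m, g c + (1 - r) * if P.rep m = m then p else 0) /
    (1 - r + (P.classes m).card * r)

/-- The solution of the linear system for the values at the labels `j ≤ m`, see
`sphereSystem_iff`. -/
def sphereSolution (P : LabelPartition) (m : ℕ) (r : ℂ) (g : ℕ → ℂ) (p : ℂ) (j : ℕ) : ℂ :=
  if P.rep j < m then
    (g (P.rep j) - r * P.sphereTotal m r g p) / (1 - r) / P.classCard (m + 1) (P.rep j)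
  else p

variable {P : LabelPartition} {m : ℕ} {r p : ℂ} {g : ℕ → ℂ}

theorem le_norm_one_sub_add (hr : ‖r‖ * (m + 1) ≤ 1 / 1000) :
    99 / 100 ≤ ‖1 - r + (P.classes m).card * r‖ := by
  have hK : ((P.classes m).card : ℝ) ≤ m := by exact_mod_cast P.card_classes_le m
  have h : ‖(1 - (P.classes m).card) * r‖ ≤ 1 / 1000 := by
    rw [norm_mul, mul_comm]
    refine (mul_le_mul_of_nonneg_left ?_ (norm_nonneg r)).trans hr
    refine (norm_sub_le _ _).trans ?_
    rw [norm_one, Complex.norm_natCast]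
    linarith
  convert le_norm_one_sub h using 2
  ring

theorem eq_sphereSolution_iff {y : ℕ → ℂ} (hy : ∀ j < m + 1, y (P.rep j) = y j) :
    (∀ j < m + 1, y j = P.sphereSolution m r g p j) ↔
      (∀ c ∈ P.classes m, y c = (g c - r * P.sphereTotal m r g p) / (1 - r) /
        P.classCard (m + 1) c) ∧ (P.rep m = m → y m = p) := by
  refine ⟨fun h => ⟨fun c hc => ?_, fun hm => ?_⟩, fun ⟨h, hm⟩ j hj => ?_⟩
  · obtain ⟨hcm, hc⟩ := mem_classes.1 hc
    rw [h c (by omega), sphereSolution, hc, if_pos hcm]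
  · rw [h m (by omega), sphereSolution, hm, if_neg (lt_irrefl m)]
  · rw [sphereSolution]
    split_ifs with hjm
    · rw [← hy j hj, h _ (rep_mem_classes hjm)]
    · have := P.rep_le j
      obtain rfl : j = m := by omega
      exact hm (by omega)

theorem sphereSystem_iff (hr : ‖r‖ * (m + 1) ≤ 1 / 1000) {y : ℕ → ℂ}
    (hy : ∀ j < m + 1, y (P.rep j) = y j) :
    ((∀ c ∈ P.classes m, (1 - r) * P.classSum (m + 1) c y +
        r * ∑ j ∈ Finset.range (m + 1), y j = g c) ∧ (P.rep m = m → y m = p)) ↔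
      ∀ j < m + 1, y j = P.sphereSolution m r g p j := by
  have h₁ : 1 - r ≠ 0 :=
    norm_pos_iff.1 ((by norm_num : (0 : ℝ) < 99 / 100).trans_le
      (le_norm_one_sub (norm_le_of_mul_le hr)))
  have h₂ : 1 - r + (P.classes m).card * r ≠ 0 :=
    norm_pos_iff.1 ((by norm_num : (0 : ℝ) < 99 / 100).trans_le (le_norm_one_sub_add hr))
  rw [eq_sphereSolution_iff hy]
  refine and_congr_left fun hm => ?_
  have hnew : (if P.rep m = m then y m else 0) = if P.rep m = m then p else 0 :=
    ite_congr rfl hm fun _ => rfl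
  rw [sum_range_succ_eq_sum_classSum_add (P := P), hnew, rankOne_system_iff h₁ h₂]
  refine forall₂_congr fun c hc => ?_
  have hcard : (P.classCard (m + 1) c : ℂ) ≠ 0 :=
    Nat.cast_ne_zero.2 (classCard_pos (classes_mono m.le_succ hc)).ne'
  rw [classSum_eq_mul hy, eq_div_iff hcard, mul_comm, sphereTotal]

theorem sphereSolution_rep (j : ℕ) :
    P.sphereSolution m r g p (P.rep j) = P.sphereSolution m r g p j := by
  rw [sphereSolution, P.rep_rep, sphereSolution]

theorem norm_sphereTotal_le (hr : ‖r‖ * (m + 1) ≤ 1 / 1000) {M : ℝ}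
    (hg : ∀ c ∈ P.classes m, ‖g c‖ ≤ 20 * P.classCard (m + 1) c * M) (hp : ‖p‖ ≤ M) :
    ‖P.sphereTotal m r g p‖ ≤ 30 * (m + 1) * M := by
  have hM : 0 ≤ M := (norm_nonneg p).trans hp
  have hsum : ‖∑ c ∈ P.classes m, g c‖ ≤ 20 * (m + 1) * M := by
    refine (norm_sum_le_of_le _ hg).trans ?_
    rw [← Finset.sum_mul, ← Finset.mul_sum]
    gcongr
    exact_mod_cast sum_classCard_le m.le_succ
  have hnew : ‖(1 - r) * if P.rep m = m then p else 0‖ ≤ 2 * M := by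
    rw [norm_mul]
    gcongr
    · refine (norm_sub_le _ _).trans ?_
      rw [norm_one]
      linarith [norm_le_of_mul_le hr]
    · split_ifs
      exacts [hp, norm_zero.trans_le hM]
  have hden := le_norm_one_sub_add (P := P) hr
  have hmM : 0 ≤ m * M := by positivity
  rw [sphereTotal, norm_div, div_le_iff₀ (by linarith)]
  calc _ ≤ 20 * (m + 1) * M + 2 * M := (norm_add_le _ _).trans (add_le_add hsum hnew)
    _ ≤ 30 * (m + 1) * M * (99 / 100) := by linarith
    _ ≤ _ := by gcongr

theorem norm_sphereSolution_le (hr : ‖r‖ * (m + 1) ≤ 1 / 1000) {M : ℝ}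
    (hg : ∀ c ∈ P.classes m, ‖g c‖ ≤ 20 * P.classCard (m + 1) c * M) (hp : ‖p‖ ≤ M) (j : ℕ) :
    ‖P.sphereSolution m r g p j‖ ≤ 100 * M := by
  have hM : 0 ≤ M := (norm_nonneg p).trans hp
  rw [sphereSolution]
  split_ifs with hj
  · have hc := rep_mem_classes (P := P) hj
    set q := P.classCard (m + 1) (P.rep j)
    have hq : (1 : ℝ) ≤ q := by exact_mod_cast classCard_pos (classes_mono m.le_succ hc)
    have hT : ‖r * P.sphereTotal m r g p‖ ≤ M := by
      calc ‖r * P.sphereTotal m r g p‖ ≤ ‖r‖ * (30 * (m + 1) * M) := by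
            rw [norm_mul]
            gcongr
            exact norm_sphereTotal_le hr hg hp
        _ = ‖r‖ * (m + 1) * (30 * M) := by ring
        _ ≤ 1 / 1000 * (30 * M) := by gcongr
        _ ≤ M := by linarith
    have hden := le_norm_one_sub (norm_le_of_mul_le hr)
    rw [norm_div, norm_div, Complex.norm_natCast, div_div, div_le_iff₀ (by positivity)]
    calc _ ≤ 20 * q * M + M := (norm_sub_le _ _).trans (add_le_add (hg _ hc) hT)
      _ ≤ 100 * M * (99 / 100 * q) := by nlinarith
      _ ≤ _ := by gcongr
  · linarith

end SphereSystem

end LabelPartition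

/-! ### Solving the difference equation sphere by sphere -/

/-- The ratio of the couplings of level `k` between different classes and inside a class. -/
def couplingRatio (κ : ℂ) (k : ℕ) : ℂ := sinSol κ (shortLength k) / sinSol κ (longLength k)

theorem norm_couplingRatio_mul_le {κ : ℂ} (hκ : ‖κ‖ = 1) (k : ℕ) :
    ‖couplingRatio κ k‖ * (k + 1) ≤ 1 / 1000 := by
  have hshort := norm_sinSol_le hκ (shortLength_pos k).le (shortLength_le_eighth k)
  have hlong := norm_inv_sinSol_le hκ (longLength_pos k) (longLength_le_eighth k)
  have hL := longLength_pos k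
  have hS := shortLength_pos k
  calc ‖couplingRatio κ k‖ * (k + 1)
      ≤ 3 / 2 * shortLength k * (2 / longLength k) * (k + 1) := by
        rw [couplingRatio, div_eq_mul_inv, norm_mul]
        gcongr
    _ = 3 * ((k + 1) * longLength k) := by rw [shortLength]; field_simp
    _ ≤ 1 / 1000 := by linarith [add_one_mul_longLength_le k]

namespace LabelPartition

section Solve

variable {P : LabelPartition} {κ : ℂ}

theorem levelLength_rep (k i j : ℕ) : P.levelLength k (P.rep i) j = P.levelLength k i j := by
  rw [levelLength, P.rep_rep, levelLength]

theorem sum_coupling_mul (hκ : ‖κ‖ = 1) (k i m : ℕ) (y : ℕ → ℂ) :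
    sinSol κ (shortLength k) * ∑ j ∈ Finset.range m, P.coupling κ k i j * y j =
      (1 - couplingRatio κ k) * P.classSum m (P.rep i) y +
        couplingRatio κ k * ∑ j ∈ Finset.range m, y j := by
  have hshort := sinSol_ne_zero hκ (shortLength_pos k) (shortLength_le_eighth k)
  have hlong := sinSol_ne_zero hκ (longLength_pos k) (longLength_le_eighth k)
  rw [classSum, Finset.sum_filter, Finset.mul_sum, Finset.mul_sum, Finset.mul_sum,
    ← Finset.sum_add_distrib]
  refine Finset.sum_congr rfl fun j _ => ?_
  rw [coupling, levelLength, couplingRatio]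
  simp only [eq_comm (a := P.rep i)]
  split_ifs
  · field_simp
    ring
  · field_simp
    ring

theorem totalPotential_ne_zero (hκ : ‖κ‖ = 1) (n i : ℕ) : P.totalPotential κ n i ≠ 0 := by
  have hpos (k j : ℕ) : 0 < (P.potential κ k i j).re :=
    re_cosSol_div_sinSol_pos hκ (P.levelLength_pos _ _ _) (P.levelLength_le_eighth _ _ _)
  have hre : 0 < (P.totalPotential κ n i).re := by
    rw [totalPotential, Complex.add_re, Complex.re_sum, Complex.re_sum]
    exact add_pos_of_pos_of_nonneg (Finset.sum_pos (fun j _ => hpos _ j) ⟨0, by simp⟩)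
      (Finset.sum_nonneg fun j _ => (hpos _ j).le)
  exact fun h => hre.ne' (by rw [h, Complex.zero_re])

/-- The right-hand side of the linear system for the values on the sphere `n + 1`, given the values
`y₀` and `y₁` on the spheres `n - 1` and `n`. -/
def sphereData (P : LabelPartition) (κ : ℂ) (n : ℕ) (y₀ y₁ : ℕ → ℂ) (i : ℕ) : ℂ :=
  sinSol κ (shortLength (n + 1)) * (P.totalPotential κ n i * y₁ i -
    ∑ j ∈ Finset.range n, P.coupling κ n i j * y₀ j)

theorem sphereEquation_iff (hκ : ‖κ‖ = 1) {n i : ℕ} {y₀ y₁ y₂ : ℕ → ℂ} :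
    P.SphereEquation κ n i y₀ y₁ y₂ ↔
      (1 - couplingRatio κ (n + 1)) * P.classSum (n + 2) (P.rep i) y₂ +
        couplingRatio κ (n + 1) * ∑ j ∈ Finset.range (n + 2), y₂ j =
          P.sphereData κ n y₀ y₁ i := by
  rw [SphereEquation, ← sum_coupling_mul hκ, sphereData, ← eq_sub_iff_add_eq]
  exact (mul_right_inj'
    (sinSol_ne_zero hκ (shortLength_pos (n + 1)) (shortLength_le_eighth (n + 1)))).symm

theorem sphereEquation_congr {n i : ℕ} {y₀ y₁ y₂ z₀ z₁ z₂ : ℕ → ℂ} (h₀ : ∀ j < n, y₀ j = z₀ j)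
    (h₁ : y₁ i = z₁ i) (h₂ : ∀ j < n + 2, y₂ j = z₂ j) :
    P.SphereEquation κ n i y₀ y₁ y₂ ↔ P.SphereEquation κ n i z₀ z₁ z₂ := by
  rw [SphereEquation, SphereEquation, h₁,
    Finset.sum_congr rfl fun j hj => by rw [h₂ j (Finset.mem_range.1 hj)],
    Finset.sum_congr (s₁ := Finset.range n) rfl fun j hj => by rw [h₀ j (Finset.mem_range.1 hj)]]

theorem sphereEquation_rep_iff {n i : ℕ} {y₀ y₁ y₂ : ℕ → ℂ} (hy : y₁ (P.rep i) = y₁ i) :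
    P.SphereEquation κ n (P.rep i) y₀ y₁ y₂ ↔ P.SphereEquation κ n i y₀ y₁ y₂ := by
  simp only [SphereEquation, totalPotential, coupling, potential, levelLength_rep, hy]

theorem norm_sum_levelLength_mul_le {φ : ℝ → ℂ} (hφ : ∀ L, 0 < L → L ≤ 1 / 8 → ‖φ L‖ ≤ 2 / L)
    {y : ℕ → ℂ} {M : ℝ} (hy : ∀ j, ‖y j‖ ≤ M) {k m : ℕ} (hm : m ≤ k + 1) (i : ℕ) :
    ‖∑ j ∈ Finset.range m, φ (P.levelLength k i j) * y j‖ ≤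
      (P.classCard m (P.rep i) + 1) * (2 / shortLength k) * M := by
  have hM : 0 ≤ M := (norm_nonneg _).trans (hy 0)
  have hL := longLength_pos k
  have hS := shortLength_pos k
  have hterm (j : ℕ) : ‖φ (P.levelLength k i j) * y j‖ ≤
      ((if P.rep j = P.rep i then 2 / shortLength k else 0) + 2 / longLength k) * M := by
    rw [norm_mul]
    refine mul_le_mul ((hφ _ (P.levelLength_pos k i j) (P.levelLength_le_eighth k i j)).trans ?_)
      (hy j) (norm_nonneg _) (by positivity)
    rw [levelLength]
    simp only [eq_comm (a := P.rep i)]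
    split_ifs
    · exact le_add_of_nonneg_right (by positivity)
    · rw [zero_add]
  have hlong : m * (2 / longLength k) ≤ 2 / shortLength k := by
    have h : m * longLength k ≤ 1 := by
      calc m * longLength k ≤ (k + 1) * longLength k := by gcongr; exact_mod_cast hm
        _ ≤ 1 := (add_one_mul_longLength_le k).trans (by norm_num)
    calc m * (2 / longLength k) = m * longLength k * (2 / shortLength k) := by
          rw [shortLength]
          field_simp
      _ ≤ 2 / shortLength k := mul_le_of_le_one_left (by positivity) h
  calc _ ≤ (P.classCard m (P.rep i) * (2 / shortLength k) + m * (2 / longLength k)) * M := by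
        refine (norm_sum_le_of_le _ fun j _ => hterm j).trans_eq ?_
        rw [← Finset.sum_mul, Finset.sum_add_distrib, ← Finset.sum_filter, Finset.sum_const,
          Finset.sum_const, Finset.card_range, nsmul_eq_mul, nsmul_eq_mul, classCard]
    _ ≤ _ := by
        gcongr
        linarith

theorem norm_sum_levelLength_mul_le_of_mem {φ : ℝ → ℂ}
    (hφ : ∀ L, 0 < L → L ≤ 1 / 8 → ‖φ L‖ ≤ 2 / L) {y : ℕ → ℂ} {M : ℝ} (hy : ∀ j, ‖y j‖ ≤ M)
    {n k m c : ℕ} (hc : c ∈ P.classes (n + 1)) (hk : k ≤ n + 1) (hm : m ≤ k + 1) :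
    ‖∑ j ∈ Finset.range m, φ (P.levelLength k c j) * y j‖ ≤
      4 * P.classCard (n + 2) c / shortLength (n + 1) * M := by
  have hM : 0 ≤ M := (norm_nonneg _).trans (hy 0)
  have hS := shortLength_pos (n + 1)
  have hk₀ := shortLength_pos k
  have hshort : shortLength (n + 1) ≤ shortLength k := shortLength_antitone hk
  have hcard : (P.classCard m c : ℝ) ≤ P.classCard (n + 2) c :=
    Nat.cast_le.2 (classCard_mono (by omega) c)
  have hpos : (1 : ℝ) ≤ P.classCard (n + 2) c :=
    Nat.one_le_cast.2 (classCard_pos (classes_mono (Nat.le_succ _) hc))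
  refine (norm_sum_levelLength_mul_le hφ hy hm c).trans ?_
  rw [(mem_classes.1 hc).2]
  calc (P.classCard m c + 1) * (2 / shortLength k) * M
      ≤ (P.classCard (n + 2) c + P.classCard (n + 2) c) * (2 / shortLength (n + 1)) * M := by
        gcongr
    _ = _ := by ring

theorem norm_sphereData_le (hκ : ‖κ‖ = 1) {n : ℕ} {y₀ y₁ : ℕ → ℂ} {M : ℝ}
    (h₀ : ∀ j, ‖y₀ j‖ ≤ M) (h₁ : ∀ j, ‖y₁ j‖ ≤ M) {c : ℕ} (hc : c ∈ P.classes (n + 1)) :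
    ‖P.sphereData κ n y₀ y₁ c‖ ≤ 20 * P.classCard (n + 2) c * M := by
  have hM : 0 ≤ M := (norm_nonneg _).trans (h₀ 0)
  have hcot (L : ℝ) := norm_cosSol_div_sinSol_le (κ := κ) (L := L) hκ
  have hinv (L : ℝ) := norm_inv_sinSol_le (κ := κ) (L := L) hκ
  set S := shortLength (n + 1)
  have hS : 0 < S := shortLength_pos _
  set q : ℝ := ((P.classCard (n + 2) c : ℕ) : ℝ)
  have hup : ‖(∑ j ∈ Finset.range (n + 2), P.potential κ (n + 1) c j) * y₁ c‖ ≤ 4 * q / S * M := by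
    rw [Finset.sum_mul]
    exact norm_sum_levelLength_mul_le_of_mem hcot (fun _ => h₁ c) hc le_rfl le_rfl
  have hdown : ‖(∑ j ∈ Finset.range n, P.potential κ n c j) * y₁ c‖ ≤ 4 * q / S * M := by
    rw [Finset.sum_mul]
    exact norm_sum_levelLength_mul_le_of_mem hcot (fun _ => h₁ c) hc n.le_succ n.le_succ
  have hcoupling : ‖∑ j ∈ Finset.range n, P.coupling κ n c j * y₀ j‖ ≤ 4 * q / S * M :=
    norm_sum_levelLength_mul_le_of_mem hinv h₀ hc n.le_succ n.le_succ
  calc ‖P.sphereData κ n y₀ y₁ c‖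
      ≤ 3 / 2 * S * (4 * q / S * M + 4 * q / S * M + 4 * q / S * M) := by
        rw [sphereData, norm_mul, totalPotential, add_mul]
        refine mul_le_mul (norm_sinSol_le hκ hS.le (shortLength_le_eighth _)) ?_ (norm_nonneg _)
          (by positivity)
        exact (norm_sub_le _ _).trans
          (add_le_add ((norm_add_le _ _).trans (add_le_add hup hdown)) hcoupling)
    _ = 18 * q * M := by field_simp; ring
    _ ≤ 20 * q * M := by gcongr; norm_num

/-- The values on the spheres `n - 1` and `n` of the solution whose value at the vertex that
represents a new class `j` is `p j`. -/
def sphereValues (P : LabelPartition) (κ : ℂ) (p : ℕ → ℂ) : ℕ → (ℕ → ℂ) × (ℕ → ℂ)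
  | 0 => (0, fun _ => p 0)
  | n + 1 => ((P.sphereValues κ p n).2, P.sphereSolution (n + 1) (couplingRatio κ (n + 1))
      (P.sphereData κ n (P.sphereValues κ p n).1 (P.sphereValues κ p n).2) (p (n + 1)))

variable {p : ℕ → ℂ}

theorem sphereValues_rep (n j : ℕ) :
    (P.sphereValues κ p n).2 (P.rep j) = (P.sphereValues κ p n).2 j := by
  cases n with
  | zero => rfl
  | succ n => exact sphereSolution_rep j

theorem norm_sphereValues_le (hκ : ‖κ‖ = 1) {B : ℝ} (hp : ∀ j, ‖p j‖ ≤ B) (n j : ℕ) :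
    ‖(P.sphereValues κ p n).1 j‖ ≤ B * 100 ^ n ∧ ‖(P.sphereValues κ p n).2 j‖ ≤ B * 100 ^ n := by
  have hB : 0 ≤ B := (norm_nonneg _).trans (hp 0)
  induction n generalizing j with
  | zero => simpa [sphereValues, hB] using hp 0
  | succ n ih =>
    have hmono : B * 100 ^ n ≤ B * 100 ^ (n + 1) := by gcongr <;> norm_num
    have hpn : ‖p (n + 1)‖ ≤ B * 100 ^ n :=
      (hp _).trans (le_mul_of_one_le_right hB (one_le_pow₀ (by norm_num)))
    refine ⟨(ih j).2.trans hmono, ?_⟩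
    calc _ ≤ 100 * (B * 100 ^ n) := norm_sphereSolution_le (norm_couplingRatio_mul_le hκ (n + 1))
          (fun c hc => norm_sphereData_le hκ (fun j => (ih j).1) (fun j => (ih j).2) hc) hpn j
      _ = B * 100 ^ (n + 1) := by ring

theorem sphereSystem_sphereValues (hκ : ‖κ‖ = 1) (p : ℕ → ℂ) (n : ℕ) :
    (∀ c ∈ P.classes (n + 1), P.SphereEquation κ n c (P.sphereValues κ p n).1
      (P.sphereValues κ p n).2 (P.sphereValues κ p (n + 1)).2) ∧
        (P.rep (n + 1) = n + 1 → (P.sphereValues κ p (n + 1)).2 (n + 1) = p (n + 1)) := by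
  have h := (sphereSystem_iff (norm_couplingRatio_mul_le hκ (n + 1))
    (y := (P.sphereValues κ p (n + 1)).2) fun j _ => sphereValues_rep (n + 1) j).2 fun j _ => rfl
  refine ⟨fun c hc => (sphereEquation_iff hκ).2 ?_, h.2⟩
  rw [(mem_classes.1 hc).2]
  exact h.1 c hc

theorem exists_discreteSolution (P : LabelPartition) (hκ : ‖κ‖ = 1) {B : ℝ}
    (hp : ∀ j, ‖p j‖ ≤ B) :
    ∃ x : (Σ n, Fin (n + 1)) → ℂ, DiscreteSolution P.edgeLength κ x ∧
      (∀ j, P.rep j = j → x (vtx j j) = p j) ∧ ∀ v, ‖x v‖ ≤ B * 100 ^ v.1 := by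
  set x : (Σ n, Fin (n + 1)) → ℂ := fun v => (P.sphereValues κ p v.1).2 v.2
  have hx {n j : ℕ} (hj : j < n + 1) : x (vtx n j) = (P.sphereValues κ p n).2 j := by
    change (P.sphereValues κ p n).2 (vtx n j).2 = _
    rw [vtx_snd hj]
  have hprev (n : ℕ) : ∀ j < n, x (vtx (n - 1) j) = (P.sphereValues κ p n).1 j := by
    cases n with
    | zero => exact fun j hj => absurd hj j.not_lt_zero
    | succ n => exact fun j hj => hx hj
  refine ⟨x, discreteSolution_iff.2 fun n i hi => ?_, fun j hj => ?_,
    fun v => (norm_sphereValues_le hκ hp _ _).2⟩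
  · rw [sphereEquation_congr (hprev n) (hx hi) fun j hj => hx hj,
      ← sphereEquation_rep_iff (sphereValues_rep n i)]
    exact (sphereSystem_sphereValues hκ p n).1 _ (rep_mem_classes ((P.rep_le i).trans_lt hi))
  · rw [hx j.lt_succ_self]
    cases j with
    | zero => rfl
    | succ j => exact (sphereSystem_sphereValues hκ p j).2 hj

end Solve

end LabelPartition

section Uniqueness

variable {P : LabelPartition} {κ : ℂ} {x : (Σ n, Fin (n + 1)) → ℂ}

open LabelPartition

theorem DiscreteSolution.apply_rep (hκ : ‖κ‖ = 1) (hx : DiscreteSolution P.edgeLength κ x) {n i : ℕ}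
    (hi : i < n + 1) : x (vtx n (P.rep i)) = x (vtx n i) := by
  have h := discreteSolution_iff.1 hx n
  have hrep := h (P.rep i) ((P.rep_le i).trans_lt hi)
  simp only [SphereEquation, totalPotential, coupling, potential, levelLength_rep] at hrep
  exact mul_left_cancel₀ (totalPotential_ne_zero hκ n i) (hrep.symm.trans (h i hi))

theorem DiscreteSolution.eq_zero (hκ : ‖κ‖ = 1) (hx : DiscreteSolution P.edgeLength κ x)
    (h₀ : ∀ j, P.rep j = j → x (vtx j j) = 0) : x = 0 := by
  suffices h : ∀ n, (∀ i < n + 1, x (vtx n i) = 0) ∧ ∀ i < n, x (vtx (n - 1) i) = 0 by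
    funext ⟨n, i⟩
    rw [← vtx_val]
    exact (h n).1 i i.2
  intro n
  induction n with
  | zero =>
    refine ⟨fun i hi => ?_, fun i hi => absurd hi (Nat.not_lt_zero i)⟩
    obtain rfl : i = 0 := by omega
    exact h₀ 0 (Nat.le_zero.1 (P.rep_le 0))
  | succ n ih =>
    have hsystem : ∀ c ∈ P.classes (n + 1), (1 - couplingRatio κ (n + 1)) *
        P.classSum (n + 2) c (fun j => x (vtx (n + 1) j)) + couplingRatio κ (n + 1) *
          ∑ j ∈ Finset.range (n + 2), x (vtx (n + 1) j) = 0 := fun c hc => by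
      obtain ⟨hcn, hc⟩ := mem_classes.1 hc
      have h := (sphereEquation_iff hκ).1 (discreteSolution_iff.1 hx n c hcn)
      rw [hc] at h
      rw [h, sphereData, ih.1 c hcn, Finset.sum_eq_zero fun j hj => by
        rw [ih.2 j (Finset.mem_range.1 hj), mul_zero]]
      simp
    refine ⟨fun i hi => ?_, ih.1⟩
    rw [(sphereSystem_iff (g := 0) (norm_couplingRatio_mul_le hκ (n + 1))
      fun j hj => hx.apply_rep hκ hj).1 ⟨hsystem, h₀ (n + 1)⟩ i hi]
    simp [sphereSolution, sphereTotal]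

end Uniqueness

/-! ### The deficiency index -/

theorem neighborSet_nonempty (v : Σ n, Fin (n + 1)) : Nonempty (linearAntitree.neighborSet v) :=
  ⟨⟨vtx (v.1 + 1) 0, Or.inl rfl⟩⟩

theorem summable_vertices :
    Summable fun v : (Σ n, Fin (n + 1)) => (1 / 2 : ℝ) ^ v.1 * (1 / 2 : ℝ) ^ (v.2 : ℕ) := by
  have hs : Summable fun n : ℕ => (1 / 2 : ℝ) ^ n :=
    summable_geometric_of_lt_one (by norm_num) (by norm_num)
  refine (hs.mul_of_nonneg hs (fun n => by positivity) fun n => by positivity).comp_injective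
    (i := fun v : (Σ n, Fin (n + 1)) => (v.1, (v.2 : ℕ))) ?_
  rintro ⟨n, i⟩ ⟨m, j⟩ h
  obtain ⟨rfl, h⟩ := Prod.mk.inj h
  exact congrArg _ (Fin.ext h)

theorem summable_edges (o : Orientation linearAntitree) :
    Summable fun e : linearAntitree.edgeSet => (1 / 16 : ℝ) ^ max (o.tail e).1 (o.head e).1 := by
  have hsum := summable_vertices.mul_of_nonneg summable_vertices (fun v => by positivity)
    fun v => by positivity
  have hinj : Function.Injective fun e => (o.tail e, o.head e) := fun e e' h => by
    obtain ⟨ht, hh⟩ := Prod.mk.inj h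
    exact Subtype.ext (by rw [← o.mk_eq, ← o.mk_eq, ht, hh])
  refine Summable.of_nonneg_of_le (fun e => by positivity) (fun e => ?_) (hsum.comp_injective hinj)
  have hle : (o.tail e).1 + (o.tail e).2 + ((o.head e).1 + (o.head e).2) ≤
      4 * max (o.tail e).1 (o.head e).1 := by
    have := (o.tail e).2.2
    have := (o.head e).2.2
    omega
  rw [Function.comp_apply, ← pow_add, ← pow_add, ← pow_add,
    show (1 / 16 : ℝ) = (1 / 2) ^ 4 by norm_num, ← pow_mul]
  exact pow_le_pow_of_le_one (by norm_num) (by norm_num) hle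

theorem toENat_rank_eq_card {K V ι : Type*} [CommRing K] [Nontrivial K] [AddCommGroup V]
    [Module K V] [DecidableEq ι] {Φ : V →ₗ[K] ι → K} (hΦ : Function.Injective Φ)
    (hsingle : ∀ j, ∃ x, Φ x = Pi.single j 1) :
    Cardinal.toENat (Module.rank K V) = ENat.card ι := by
  choose x hx using hsingle
  have hx : LinearIndependent K x := .of_comp Φ <| by
    rw [show Φ ∘ x = fun j => Pi.single j 1 from funext hx]
    exact Pi.linearIndependent_single_one _ _
  refine le_antisymm ?_ ?_
  · rcases finite_or_infinite ι with _ | _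
    · have := Fintype.ofFinite ι
      simpa [rank_pi, ENat.card] using
        OrderHomClass.mono Cardinal.toENat (LinearMap.lift_rank_le_of_injective Φ hΦ)
    · rw [ENat.card_eq_top_of_infinite]
      exact le_top
  · have := OrderHomClass.mono Cardinal.toENat hx.cardinal_lift_le_rank
    simpa [ENat.card] using this

namespace LabelPartition

variable (P : LabelPartition) (o : Orientation linearAntitree) {κ : ℂ}

theorem edgeLength_le (e : linearAntitree.edgeSet) :
    P.edgeLength e ≤ (1 / 10 ^ 6) ^ max (o.tail e).1 (o.head e).1 := by
  rw [P.edgeLength_eq o]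
  exact (P.levelLength_le _ _ _).trans
    (pow_le_pow_of_le_one (by norm_num) (by norm_num) (Nat.le_succ _))

theorem memℓp_interpolationLp (hκ : ‖κ‖ = 1) {x : (Σ n, Fin (n + 1)) → ℂ} {B : ℝ}
    (hx : ∀ v, ‖x v‖ ≤ B * 100 ^ v.1) :
    Memℓp (fun e => interpolationLp o P.edgeLength κ e x) 2 := by
  have hB : 0 ≤ B := by simpa [vtx] using (norm_nonneg _).trans (hx (vtx 0 0))
  refine QuantumGraph.memℓp_interpolationLp (P.sinSol_edgeLength_ne_zero hκ) P.edgeLength_pos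
    (K := 4) (M := fun e => B * 100 ^ max (o.tail e).1 (o.head e).1) (fun e t ht => ?_)
    (fun e v hv => (hx v).trans ?_) ?_
  · have := norm_sinSol_le hκ ht.1 (ht.2.trans (P.edgeLength_le_eighth e))
    have := le_norm_sinSol hκ (P.edgeLength_pos e).le (P.edgeLength_le_eighth e)
    linarith [ht.1, ht.2]
  · gcongr
    · norm_num
    · obtain rfl | rfl := o.mem_iff.1 hv
      exacts [le_max_left _ _, le_max_right _ _]
  · refine Summable.of_nonneg_of_le (fun e => mul_nonneg (P.edgeLength_pos e).le (sq_nonneg _))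
      (fun e => ?_) ((summable_edges o).mul_left (B ^ 2))
    set k := max (o.tail e).1 (o.head e).1
    calc P.edgeLength e * (B * 100 ^ k) ^ 2
        ≤ (1 / 10 ^ 6) ^ k * (B * 100 ^ k) ^ 2 := by
          gcongr
          exact P.edgeLength_le o e
      _ = B ^ 2 * (1 / 100) ^ k := by
          rw [mul_pow, ← pow_mul, mul_comm k 2, pow_mul, mul_left_comm, ← mul_pow]
          norm_num
      _ ≤ B ^ 2 * (1 / 16) ^ k := by
          gcongr
          norm_num

/-- The values of a solution at the vertices that represent a new class. -/
def classValues (κ : ℂ) : solutionSpace o P.edgeLength κ →ₗ[ℂ] ({j | P.rep j = j} → ℂ) :=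
  (LinearMap.pi fun j : {j | P.rep j = j} => LinearMap.proj (vtx j j)).comp (Submodule.subtype _)

theorem classValues_injective (hκ : ‖κ‖ = 1) : Function.Injective (P.classValues o κ) := by
  rw [← LinearMap.ker_eq_bot, LinearMap.ker_eq_bot']
  exact fun x hx => Subtype.ext (x.2.1.eq_zero hκ fun j hj => congrFun hx ⟨j, hj⟩)

theorem exists_classValues_eq_single (hκ : ‖κ‖ = 1) (j : {j | P.rep j = j}) :
    ∃ x, P.classValues o κ x = Pi.single j 1 := by
  obtain ⟨x, hx, hxp, hxb⟩ := P.exists_discreteSolution (p := Pi.single j.1 1) (B := 1) hκ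
    fun i => by
      rw [Pi.single_apply]
      split_ifs <;> simp
  refine ⟨⟨x, hx, P.memℓp_interpolationLp o hκ hxb⟩, funext fun i => (hxp i i.2).trans ?_⟩
  simp only [Pi.single_apply, Subtype.ext_iff]

theorem defect_minimalLaplacian {z : ℂ} (hz : ‖z‖ = 1) :
    defect (minimalLaplacian o P.edgeLength_pos) z = {j | P.rep j = j}.encard := by
  obtain ⟨κ, hκz⟩ := IsAlgClosed.exists_pow_nat_eq (-z) two_pos
  have hκ : ‖κ‖ = 1 := by
    rw [← pow_eq_one_iff_of_nonneg (norm_nonneg κ) two_ne_zero, ← norm_pow, hκz, norm_neg, hz]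
  have hκ₀ : κ ≠ 0 := norm_ne_zero_iff.1 (hκ ▸ one_ne_zero)
  obtain rfl : z = -κ ^ 2 := by rw [hκz, neg_neg]
  rw [defect, rank_deficiencySubspace_eq (P.sinSol_edgeLength_ne_zero hκ) hκ₀ P.edgeLength_pos
    neighborSet_nonempty]
  exact toENat_rank_eq_card (P.classValues_injective o hκ) (P.exists_classValues_eq_single o hκ)

end LabelPartition

theorem exists_labelPartition (N : ℕ∞) (hN : 1 ≤ N) :
    ∃ P : LabelPartition, {j | P.rep j = j}.encard = N := by
  induction N using ENat.recTopCoe with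
  | top => exact ⟨⟨id, fun _ => le_rfl, fun _ => rfl⟩, by simp⟩
  | coe n =>
    have hn : 1 ≤ n := by exact_mod_cast hN
    refine ⟨⟨fun i => min i (n - 1), fun i => min_le_left _ _, fun i => by simp⟩, ?_⟩
    have h : {j | min j (n - 1) = j} = (Finset.range n : Set ℕ) := by
      ext j
      simp only [mem_ofPred_eq, Finset.coe_range, mem_Iio]
      omega
    rw [h, Set.encard_coe_eq_coe_finsetCard, Finset.card_range]

end QuantumGraph

end

theorem theorem7p1 (N : ℕ∞) (hN : 1 ≤ N) :
    ∃ (ℓ : (QuantumGraph.antitree (fun n => n + 1)).edgeSet → ℝ) (hℓ : ∀ e, 0 < ℓ e),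
      ∀ o : QuantumGraph.Orientation (QuantumGraph.antitree (fun n => n + 1)),
        QuantumGraph.defect (QuantumGraph.minimalLaplacian o hℓ) Complex.I = N ∧
        QuantumGraph.defect (QuantumGraph.minimalLaplacian o hℓ) (-Complex.I) = N := by
  obtain ⟨P, rfl⟩ := QuantumGraph.exists_labelPartition N hN
  exact ⟨P.edgeLength, P.edgeLength_pos, fun o =>
    ⟨P.defect_minimalLaplacian o (by simp), P.defect_minimalLaplacian o (by simp)⟩⟩
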